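/- Let $\Sigma=\mathbb H/\rho_0(G)$ be a closed oriented hyperbolic surface, where $\mathbb H$ is the hyperbolic plane, $G$ is a group and $\rho_0:G\to \mathrm{PSL}(2,\mathbb R)$ is a homomorphism through which $G$ acts on $\mathbb H$ freely, properly discontinuously and cocompactly (so $G\cong\pi_1(\Sigma)$). Let $X(G)$ be the space of $\mathrm{PSL}(2,\mathbb R)$-conjugacy classes of all such homomorphisms $\rho:G\to\mathrm{PSL}(2,\mathbb R)$, with the quotient of the topology of pointwise convergence, and let the Teichmüller space $\mathcal T(\Sigma)$ be the connected component of $[\rho_0]$ in $X(G)$. A function $f:\mathcal T(\Sigma)\to\mathbb R$ is called real analytic if near every point of $\mathcal T(\Sigma)$ the value $f([\rho])$ is a real-analytic function of the matrix entries of local lifts to $\mathrm{SL}(2,\mathbb R)$ of $\rho(s_1),\dots,\rho(s_n)$ for finitely many $s_1,\dots,s_n\in G$. For nontrivial $a\in G$ and $[\rho]\in\mathcal T(\Sigma)$, the oriented closed geodesic of $\mathbb H/\rho(G)$ determined by $a$ is the projection of the axis of $\rho(a)$, oriented in the direction of translation. Suppose that $\alpha_1,\alpha_2$ are oriented closed geodesics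 of $\Sigma$ that meet at a point $z$ with different unit tangent vectors there. Let $a_1,a_2\in G$ be such that the axes of $\rho_0(a_1)$, $\rho_0(a_2)$ are lifts of $\alpha_1$, $\alpha_2$ which meet in a lift of $z$ (in this way). Then for every $[\rho]\in\mathcal T(\Sigma)$ the elements $\rho(a_1),\rho(a_2)$ are hyperbolic, their oriented axes meet, and the angle $\alpha_1\angle_z\alpha_2\in[0,2\pi)$ from the first to the second, measured counter-clockwise at a point where they meet, is well defined (it depends only on $[\rho]$, $a_1$ and $a_2$) and lies in $\,]0,2\pi[$. The function $$\mathcal T(\Sigma)\to\,]0,2\pi[,\qquad [\rho]\mapsto \alpha_1\angle_z\alpha_2$$ is real analytic, and $$\sin^2(\alpha_1\angle_z\alpha_2)=\frac{4\,(2-\mathrm{tr}[A_1,A_2])}{(\mathrm{tr}^2A_1-4)(\mathrm{tr}^2A_2-4)}$$ for all lifts $A_1,A_2\in\mathrm{SL}(2,\mathbb R)$ of $\rho(a_1),\rho(a_2)$, where $[A_1,A_2]=A_1A_2A_1^{-1}A_2^{-1}$, and both factors of the denominator are positive. -/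

import Mathlib

open scoped MatrixGroups UpperHalfPlane Topology

/-- `PSL(2, ℝ)` acts on the upper half-plane by Möbius transformations. -/
noncomputable instance PSLAction : MulAction PSL(2, ℝ) ℍ :=
  MulAction.compHom ℍ Matrix.ProjectiveSpecialLinearGroup.toPGL

theorem PSL_mk_smul (A : SL(2, ℝ)) (z : ℍ) :
    (QuotientGroup.mk A : PSL(2, ℝ)) • z = A • z := rfl

/-- The representations `ρ : G → PSL(2, ℝ)` such that `G` acts on the hyperbolic plane through
`ρ` freely, properly discontinuously and cocompactly. Such a `ρ` is the same thing as a closed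
oriented hyperbolic surface `ℍ / ρ(G)` with an identification of its fundamental group (as the
group of deck transformations of `ℍ`) with `G`; it is faithful with discrete image. -/
def SurfaceRep (G : Type*) [Group G] : Type _ :=
  {ρ : G →* PSL(2, ℝ) //
    (∀ g : G, g ≠ 1 → ∀ z : ℍ, ρ g • z ≠ z) ∧
    (∀ K : Set ℍ, IsCompact K → {g : G | ∃ z ∈ K, ρ g • z ∈ K}.Finite) ∧
    (∃ K : Set ℍ, IsCompact K ∧ ∀ z : ℍ, ∃ g : G, ρ g • z ∈ K)}

namespace SurfaceRep

variable {G : Type*} [Group G]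

/-- The topology of pointwise convergence (the compact-open topology for the discrete
group `G`), with the Lie group topology on `PSL(2, ℝ)`. -/
instance : TopologicalSpace (SurfaceRep G) :=
  TopologicalSpace.induced (fun (ρ : SurfaceRep G) (g : G) => ρ.1 g) inferInstance

/-- Conjugacy by elements of `PSL(2, ℝ)`, i.e. by orientation preserving isometries of `ℍ`. -/
instance conjSetoid (G : Type*) [Group G] : Setoid (SurfaceRep G) where
  r ρ σ := ∃ h : PSL(2, ℝ), ∀ g : G, σ.1 g = h * ρ.1 g * h⁻¹
  iseqv :=
    { refl := fun _ => ⟨1, by simp⟩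
      symm := fun ⟨h, hh⟩ => ⟨h⁻¹, fun g => by rw [hh g]; group⟩
      trans := fun ⟨h, hh⟩ ⟨k, hk⟩ => ⟨k * h, fun g => by rw [hk g, hh g]; group⟩ }

end SurfaceRep

/-- The space of conjugacy classes of surface representations, with the quotient topology. -/
abbrev RepClasses (G : Type*) [Group G] : Type _ := Quotient (SurfaceRep.conjSetoid G)

/-- The class of a representation. -/
def repClass {G : Type*} [Group G] (ρ : SurfaceRep G) : RepClasses G := Quotient.mk _ ρ

/-- The Teichmüller space of the closed oriented hyperbolic surface `ℍ / ρ₀(G)`: the connected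
component of the class of `ρ₀` in the space of conjugacy classes of representations. -/
def Teich {G : Type*} [Group G] (ρ₀ : SurfaceRep G) : Set (RepClasses G) :=
  connectedComponent (repClass ρ₀)

/-- The real `2 × 2` matrix entries of a finite family of elements of `SL(2, ℝ)`. -/
def matEntries {n : ℕ} (x : Fin n → SL(2, ℝ)) : Fin n → Fin 2 → Fin 2 → ℝ :=
  fun i j k => (x i : Matrix (Fin 2) (Fin 2) ℝ) j k

/-- `f` is real analytic on Teichmüller space. The real analytic structure is the one that comes
from the character variety: near the class of each representation `ρ`, the number `f [σ]` is a
real analytic function of the matrix entries of (lifts to `SL(2, ℝ)` close to given lifts of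
the `ρ (s i)` of) finitely many of the elements `σ (s i)`. -/
def IsRealAnalytic {G : Type*} [Group G] {ρ₀ : SurfaceRep G} (f : Teich ρ₀ → ℝ) : Prop :=
  ∀ ρ : SurfaceRep G, repClass ρ ∈ Teich ρ₀ →
    ∃ (n : ℕ) (s : Fin n → G) (x : Fin n → SL(2, ℝ)) (F : (Fin n → Fin 2 → Fin 2 → ℝ) → ℝ),
      (∀ i, QuotientGroup.mk (x i) = ρ.1 (s i)) ∧
      AnalyticAt ℝ F (matEntries x) ∧
      ∀ᶠ y in 𝓝 x, ∀ (σ : SurfaceRep G) (hσ : repClass σ ∈ Teich ρ₀),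
        (∀ i, QuotientGroup.mk (y i) = σ.1 (s i)) → f ⟨repClass σ, hσ⟩ = F (matEntries y)

/-- `c : ℝ → ℍ` is a unit speed parametrised complete geodesic of the hyperbolic plane which is
translated in its positive direction by `ρ(a)`: its image is the axis of `ρ(a)`, and it is a lift
of the oriented closed geodesic of `ℍ / ρ(G)` in the free homotopy class of `a`. -/
def IsOrientedAxis {G : Type*} [Group G] (ρ : SurfaceRep G) (a : G) (c : ℝ → ℍ) : Prop :=
  Isometry c ∧ ∃ l : ℝ, 0 < l ∧ ∀ t : ℝ, ρ.1 a • c t = c (t + l)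

/-- The oriented axes of `ρ(a₁)` and `ρ(a₂)` meet in a point of `ℍ`, and `θ ∈ [0, 2π)` is the angle
there, measured counter-clockwise from the first to the second: the two unit tangent vectors
`v₁`, `v₂` at that point satisfy `v₂ = exp (i θ) v₁` (the upper half-plane model is conformal). -/
def IsIntersectionAngle {G : Type*} [Group G] (ρ : SurfaceRep G) (a₁ a₂ : G) (θ : ℝ) : Prop :=
  0 ≤ θ ∧ θ < 2 * Real.pi ∧
  ∃ c₁ c₂ : ℝ → ℍ, IsOrientedAxis ρ a₁ c₁ ∧ IsOrientedAxis ρ a₂ c₂ ∧ c₁ 0 = c₂ 0 ∧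
    ∃ v₁ v₂ : ℂ, HasDerivAt (fun t => (c₁ t : ℂ)) v₁ 0 ∧ HasDerivAt (fun t => (c₂ t : ℂ)) v₂ 0 ∧
      v₂ = Complex.exp (θ * Complex.I) * v₁

/-! A lift `A` of a surface group element acts like the flow of a quadratic vector field, `moebField
A`, whose size at `z` measures the displacement of `z`. On the axis of a hyperbolic `A`, the
direction of translation is that of `tr A` times this field; the factor `tr A` makes the choice of
lift irrelevant. At a common point of two axes the quotient of the unit tangent vectors is therefore
an explicit expression in the matrix entries (`moebField_mul_conj`): its cosine is `angleCos`, and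
its sine is a positive multiple of `crossSign`. Squaring the cosine gives the formula with the
commutator trace (`crossForm_sq`).

Every nontrivial element is hyperbolic, since the injectivity radius of a closed surface is positive
while elliptic and parabolic maps have arbitrarily small displacement. Hence a nontrivial commutator
never has trace `2`. For noncommuting `a₁`, `a₂` the continuous function `2 - tr[A₁, A₂]` thus has
no zero on the space of classes and keeps its sign on a component. Positivity means that the axes
cross, so crossing at `ρ₀` persists (`cross_of_mem_Teich`). The cosine then stays in `]-1, 1[` and
`crossSign` stays nonzero, so the angle is locally one of two analytic branches of the arccosine.

If `a₁`, `a₂` commute, the axes coincide. A nonzero angle at `ρ₀` means opposite directions, which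
again persists by a sign argument (`crossForm_neg_of_mem_Teich`), and the angle is constantly `π`.
-/

open UpperHalfPlane ComplexConjugate

/-! ### Displacement of a Möbius map -/

/-- The vector field on `ℍ` of the traceless part of `A`, up to a factor depending on `tr A`. -/
noncomputable def moebField (A : SL(2, ℝ)) (z : ℂ) : ℂ :=
  (A.1 0 1 : ℂ) + ((A.1 0 0 : ℂ) - A.1 1 1) * z - A.1 1 0 * z ^ 2

/-- The function on `ℍ` which vanishes exactly on the axis of a hyperbolic `A`. -/
noncomputable def axisForm (A : SL(2, ℝ)) (z : ℍ) : ℝ :=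
  A.1 1 0 * (z.re ^ 2 + z.im ^ 2) - (A.1 0 0 - A.1 1 1) * z.re - A.1 0 1

theorem SL2_det (A : SL(2, ℝ)) : A.1 0 0 * A.1 1 1 - A.1 0 1 * A.1 1 0 = 1 := by
  rw [← Matrix.det_fin_two]; exact A.2

theorem SL2_trace (A : SL(2, ℝ)) : A.1.trace = A.1 0 0 + A.1 1 1 := Matrix.trace_fin_two _

theorem SL2_coe_smul (A : SL(2, ℝ)) (z : ℍ) :
    ((A • z : ℍ) : ℂ) = ((A.1 0 0 : ℂ) * z + A.1 0 1) / ((A.1 1 0 : ℂ) * z + A.1 1 1) := by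
  simpa using coe_specialLinearGroup_apply A z

theorem SL2_denom_ne_zero (A : SL(2, ℝ)) (z : ℍ) : (A.1 1 0 : ℂ) * z + A.1 1 1 ≠ 0 := by
  have := UpperHalfPlane.denom_ne_zero (A : GL (Fin 2) ℝ) z
  simpa [UpperHalfPlane.denom] using this

theorem SL2_im_smul (A : SL(2, ℝ)) (z : ℍ) :
    (A • z).im = z.im / Complex.normSq ((A.1 1 0 : ℂ) * z + A.1 1 1) := by
  have h := SL2_coe_smul A z
  have h2 := congrArg Complex.im h
  rw [UpperHalfPlane.coe_im, Complex.div_im, ← sub_div] at h2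
  rw [h2]
  congr 1
  simp
  linear_combination z.im * SL2_det A

/-- Combined with the displacement formula below, this shows that a hyperbolic map moves the points
of its axis least. -/
theorem normSq_moebField (A : SL(2, ℝ)) (z : ℍ) :
    Complex.normSq (moebField A z) =
      axisForm A z ^ 2 + z.im ^ 2 * (A.1.trace ^ 2 - 4) := by
  have hd := SL2_det A
  rw [SL2_trace]
  simp only [moebField, axisForm, Complex.normSq_apply, Complex.sub_re, Complex.add_re,
    Complex.mul_re, Complex.mul_im, Complex.sub_im, Complex.add_im, Complex.ofReal_re,
    Complex.ofReal_im, pow_two, UpperHalfPlane.coe_re, UpperHalfPlane.coe_im]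
  linear_combination (-4 * z.im ^ 2) * hd

/-- The difference `A z - z` is `moebField A z` divided by the denominator of `A` at `z`, and the
square of that denominator's modulus is the ratio of the imaginary parts of `z` and `A z`. -/
theorem sinh_half_dist_smul_sq (A : SL(2, ℝ)) (z : ℍ) :
    Real.sinh (dist z (A • z) / 2) ^ 2 = Complex.normSq (moebField A z) / (4 * z.im ^ 2) := by
  have hn := SL2_denom_ne_zero A z
  have hn' : Complex.normSq ((A.1 1 0 : ℂ) * z + A.1 1 1) ≠ 0 := by simpa using hn
  have hsub : (z : ℂ) - ((A • z : ℍ) : ℂ) =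
      - moebField A z / ((A.1 1 0 : ℂ) * z + A.1 1 1) := by
    rw [SL2_coe_smul, moebField, eq_div_iff hn, sub_mul, div_mul_cancel₀ _ hn]
    ring
  have hz := z.im_pos
  rw [UpperHalfPlane.sinh_half_dist, div_pow, mul_pow,
    Real.sq_sqrt (mul_nonneg z.im_pos.le (A • z).im_pos.le), Complex.dist_eq,
    ← Complex.normSq_eq_norm_sq, hsub, Complex.normSq_div, Complex.normSq_neg, SL2_im_smul]
  field_simp
  ring

/-! ### Nontrivial elements are hyperbolic -/

theorem continuous_PSL_smul (g : PSL(2, ℝ)) : Continuous fun z : ℍ => g • z := by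
  obtain ⟨A, rfl⟩ := QuotientGroup.mk_surjective g
  exact (isometry_smul ℍ A).continuous

theorem dist_PSL_smul (g : PSL(2, ℝ)) (z w : ℍ) : dist (g • z) (g • w) = dist z w := by
  obtain ⟨A, rfl⟩ := QuotientGroup.mk_surjective g
  exact dist_smul A z w

/-- The injectivity radius of a closed surface is positive. -/
theorem SurfaceRep.exists_le_dist {G : Type*} [Group G] (ρ : SurfaceRep G) :
    ∃ δ : ℝ, 0 < δ ∧ ∀ g : G, g ≠ 1 → ∀ z : ℍ, δ ≤ dist z (ρ.1 g • z) := by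
  obtain ⟨hfree, hpd, K, hK, hcov⟩ := ρ.2
  -- An element moving a point of `K` by at most `1` sends it into the `1`-thickening, so only
  -- finitely many elements do so. For the others `1` is a lower bound on `K`.
  have hfin := hpd (Metric.cthickening 1 K) hK.cthickening
  have key : ∀ b : G, ∃ δ : ℝ, 0 < δ ∧ (b ≠ 1 → ∀ z ∈ K, δ ≤ dist z (ρ.1 b • z)) := by
    intro b
    by_cases hb : b = 1
    · exact ⟨1, one_pos, fun h => absurd hb h⟩
    rcases K.eq_empty_or_nonempty with rfl | hne
    · exact ⟨1, one_pos, by simp⟩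
    have hc : ContinuousOn (fun z : ℍ => dist z (ρ.1 b • z)) K :=
      (continuous_id.dist (continuous_PSL_smul _)).continuousOn
    obtain ⟨w, hw, hmin⟩ := hK.exists_isMinOn hne hc
    exact ⟨_, dist_pos.2 (hfree b hb w).symm, fun _ z hz => hmin hz⟩
  choose δ hδ hle using key
  obtain ⟨ε, hε, hεle⟩ : ∃ ε : ℝ, 0 < ε ∧ ∀ b ∈ hfin.toFinset, ε ≤ δ b := by
    rcases hfin.toFinset.eq_empty_or_nonempty with h | h
    · exact ⟨1, one_pos, by rw [h]; simp⟩
    · obtain ⟨b, -, hb⟩ := hfin.toFinset.exists_min_image δ h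
      exact ⟨δ b, hδ b, hb⟩
  refine ⟨min ε 1, lt_min hε one_pos, fun a ha z => ?_⟩
  -- Conjugating by an element that brings `z` into `K` reduces to points of `K`.
  obtain ⟨g, hg⟩ := hcov z
  have hb : g * a * g⁻¹ ≠ 1 := by
    intro h
    apply ha
    simpa using h
  have hd : dist z (ρ.1 a • z) = dist (ρ.1 g • z) (ρ.1 (g * a * g⁻¹) • ρ.1 g • z) := by
    rw [smul_smul, ← map_mul, inv_mul_cancel_right, map_mul, mul_smul, dist_PSL_smul]
  rw [hd]
  by_contra! hlt
  have h1 : dist (ρ.1 g • z) (ρ.1 (g * a * g⁻¹) • ρ.1 g • z) < 1 :=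
    hlt.trans_le (min_le_right _ _)
  have hmem : g * a * g⁻¹ ∈ hfin.toFinset := by
    rw [Set.Finite.mem_toFinset]
    refine ⟨ρ.1 g • z, Metric.self_subset_cthickening K hg, ?_⟩
    refine Metric.mem_cthickening_of_dist_le _ _ _ _ hg ?_
    rw [dist_comm]
    exact h1.le
  have := (hεle _ hmem).trans (hle _ hb _ hg)
  exact absurd (hlt.trans_le (min_le_left _ _)) (not_lt.2 this)

/-- An elliptic or parabolic element has arbitrarily small displacements. -/
theorem exists_normSq_moebField_le (A : SL(2, ℝ)) (hA : A.1.trace ^ 2 ≤ 4) {ε : ℝ} (hε : 0 < ε) :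
    ∃ z : ℍ, Complex.normSq (moebField A z) ≤ ε * (4 * z.im ^ 2) := by
  have hd := SL2_det A
  by_cases hc : A.1 1 0 = 0
  · have h1 : A.1 0 0 = A.1 1 1 := by
      rw [SL2_trace] at hA
      rw [hc] at hd
      have : (A.1 0 0 - A.1 1 1) ^ 2 ≤ 0 := by nlinarith
      nlinarith [sq_nonneg (A.1 0 0 - A.1 1 1), pow_eq_zero_iff (two_ne_zero) |>.1
        (le_antisymm this (sq_nonneg _))]
    -- Here `A` is plus or minus a translation and `moebField A` is constant, so points high up are
    -- hardly moved.
    obtain ⟨y, hy, hyb⟩ : ∃ y : ℝ, 0 < y ∧ A.1 0 1 ^ 2 ≤ ε * (4 * y ^ 2) := by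
      refine ⟨(A.1 0 1 ^ 2 + 1) / ε + 1, by positivity, ?_⟩
      set b := A.1 0 1
      have h2 : b ^ 2 ≤ ε * ((b ^ 2 + 1) / ε + 1) := by
        rw [mul_add, mul_div_cancel₀ _ hε.ne']
        nlinarith
      have h3 : 1 ≤ (b ^ 2 + 1) / ε + 1 := by
        have : 0 ≤ (b ^ 2 + 1) / ε := by positivity
        linarith
      refine h2.trans (mul_le_mul_of_nonneg_left ?_ hε.le)
      nlinarith
    refine ⟨⟨⟨0, y⟩, hy⟩, ?_⟩
    have : moebField A ((⟨⟨0, y⟩, hy⟩ : ℍ) : ℂ) = (A.1 0 1 : ℂ) := by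
      simp [moebField, hc, h1]
    rw [this, Complex.normSq_ofReal, ← pow_two]
    exact hyb
  · set c := A.1 1 0
    set D := A.1.trace ^ 2 - 4 with hD
    have hD0 : D ≤ 0 := by linarith
    -- Above the abscissa `(a - d) / (2c)`, the modulus of `moebField A` at height `y` is `y` times
    -- the absolute value of this bracket. For `D < 0` the bracket vanishes at the elliptic fixed
    -- point. For `D = 0` it is `c * y`, small near the parabolic fixed point.
    obtain ⟨y, hy, hyb⟩ : ∃ y : ℝ, 0 < y ∧ (c * y + D / (4 * c * y)) ^ 2 ≤ 4 * ε := by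
      rcases hD0.lt_or_eq with h | h
      · refine ⟨√(-D) / (2 * |c|), by
          have := Real.sqrt_pos.2 (neg_pos.2 h); positivity, ?_⟩
        have hs := Real.sq_sqrt (neg_pos.2 h).le
        have hs0 := (Real.sqrt_pos.2 (neg_pos.2 h)).ne'
        have hc' : |c| ≠ 0 := abs_ne_zero.2 hc
        have : c * (√(-D) / (2 * |c|)) + D / (4 * c * (√(-D) / (2 * |c|))) = 0 := by
          field_simp
          rw [hs, sq_abs]
          ring
        rw [this]
        nlinarith
      · refine ⟨2 * √ε / |c|, by have := Real.sqrt_pos.2 hε; positivity, ?_⟩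
        have hc' : |c| ≠ 0 := abs_ne_zero.2 hc
        rw [h, zero_div, add_zero, mul_pow, div_pow, sq_abs, mul_pow, Real.sq_sqrt hε.le]
        field_simp
        norm_num
    refine ⟨⟨⟨(A.1 0 0 - A.1 1 1) / (2 * c), y⟩, hy⟩, ?_⟩
    set z : ℍ := ⟨⟨(A.1 0 0 - A.1 1 1) / (2 * c), y⟩, hy⟩
    have hre : z.re = (A.1 0 0 - A.1 1 1) / (2 * c) := rfl
    have him : z.im = y := rfl
    rw [normSq_moebField, axisForm, hre, him, ← hD]
    have : (c * (((A.1 0 0 - A.1 1 1) / (2 * c)) ^ 2 + y ^ 2) -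
        (A.1 0 0 - A.1 1 1) * ((A.1 0 0 - A.1 1 1) / (2 * c)) - A.1 0 1) =
        y * (c * y - D / (4 * c * y)) := by
      rw [hD, SL2_trace]
      field_simp
      linear_combination (16 : ℝ) * hd
    change (c * (((A.1 0 0 - A.1 1 1) / (2 * c)) ^ 2 + y ^ 2) -
        (A.1 0 0 - A.1 1 1) * ((A.1 0 0 - A.1 1 1) / (2 * c)) - A.1 0 1) ^ 2 + _ ≤ _
    rw [this]
    have h2 : (y * (c * y - D / (4 * c * y))) ^ 2 + y ^ 2 * D =
        y ^ 2 * (c * y + D / (4 * c * y)) ^ 2 := by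
      field_simp
      ring
    rw [h2]
    nlinarith [sq_nonneg y]

/-- Nontrivial elements of a surface group are hyperbolic. -/
theorem SurfaceRep.four_lt_trace_sq {G : Type*} [Group G] (ρ : SurfaceRep G) {a : G} (ha : a ≠ 1)
    {A : SL(2, ℝ)} (hA : QuotientGroup.mk A = ρ.1 a) : 4 < A.1.trace ^ 2 := by
  by_contra! h
  obtain ⟨δ, hδ, hle⟩ := ρ.exists_le_dist
  have hs : 0 < Real.sinh (δ / 2) := Real.sinh_pos_iff.2 (by linarith)
  obtain ⟨z, hz⟩ := exists_normSq_moebField_le A h (ε := Real.sinh (δ / 2) ^ 2 / 2) (by positivity)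
  have h1 := hle a ha z
  rw [← hA, PSL_mk_smul] at h1
  have h2 : Real.sinh (δ / 2) ≤ Real.sinh (dist z (A • z) / 2) :=
    Real.sinh_le_sinh.2 (by linarith)
  have h3 := sinh_half_dist_smul_sq A z
  have hy : 0 < 4 * z.im ^ 2 := by have := z.im_pos; positivity
  have h4 : Real.sinh (dist z (A • z) / 2) ^ 2 ≤ Real.sinh (δ / 2) ^ 2 / 2 := by
    rw [h3, div_le_iff₀ hy]; exact hz
  have h5 := pow_le_pow_left₀ hs.le h2 2
  nlinarith

/-! ### Diagonalisation and equivariance under conjugation -/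

/-- The diagonal matrix with entries `l` and `l⁻¹`. -/
noncomputable def diagSL (l : ℝ) (hl : l ≠ 0) : SL(2, ℝ) :=
  ⟨!![l, 0; 0, l⁻¹], by simp [Matrix.det_fin_two, hl]⟩

theorem exists_add_inv_eq {t : ℝ} (ht : 4 < t ^ 2) :
    ∃ l : ℝ, l ≠ 0 ∧ 1 < l ^ 2 ∧ l + l⁻¹ = t := by
  have key : ∀ t : ℝ, 0 ≤ t → 4 < t ^ 2 → ∃ l : ℝ, l ≠ 0 ∧ 1 < l ^ 2 ∧ l + l⁻¹ = t := by
    intro t h0 ht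
    have hs := Real.sq_sqrt (show 0 ≤ t ^ 2 - 4 by linarith)
    have hs0 := Real.sqrt_nonneg (t ^ 2 - 4)
    have ht2 : 2 < t := by nlinarith
    have hl : 1 < (t + √(t ^ 2 - 4)) / 2 := by linarith
    refine ⟨(t + √(t ^ 2 - 4)) / 2, by linarith, by nlinarith, ?_⟩
    have : t + √(t ^ 2 - 4) ≠ 0 := by linarith
    field_simp
    linear_combination hs
  rcases le_total 0 t with h | h
  · exact key t h ht
  · obtain ⟨l, h1, h2, h3⟩ := key (-t) (by linarith) (by simpa using ht)
    exact ⟨-l, neg_ne_zero.2 h1, by simpa using h2, by rw [inv_neg]; linarith⟩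

/-- A hyperbolic element is conjugate to a diagonal one. -/
theorem exists_conj_diagSL (A : SL(2, ℝ)) (hA : 4 < A.1.trace ^ 2) :
    ∃ (l : ℝ) (hl : l ≠ 0) (g : SL(2, ℝ)), 1 < l ^ 2 ∧ A = g * diagSL l hl * g⁻¹ := by
  obtain ⟨l, hl, hl1, ht⟩ := exists_add_inv_eq hA
  have hd := SL2_det A
  rw [SL2_trace] at ht
  have hne : l ≠ l⁻¹ := by
    intro h
    have : l ^ 2 = 1 := by rw [pow_two]; nth_rewrite 1 [h]; exact inv_mul_cancel₀ hl
    linarith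
  have hll := mul_inv_cancel₀ hl
  have eig : ∀ m : ℝ, m * (A.1 0 0 + A.1 1 1 - m) = 1 → ∃ v0 v1 : ℝ, (v0 ≠ 0 ∨ v1 ≠ 0) ∧
      A.1 0 0 * v0 + A.1 0 1 * v1 = m * v0 ∧ A.1 1 0 * v0 + A.1 1 1 * v1 = m * v1 := by
    intro m hm
    have hdet : (A.1 - Matrix.scalar (Fin 2) m).det = 0 := by
      rw [Matrix.det_fin_two]
      simp
      linear_combination hd - hm
    obtain ⟨v, hv, hv0⟩ := Matrix.exists_mulVec_eq_zero_iff.2 hdet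
    refine ⟨v 0, v 1, ?_, ?_, ?_⟩
    · by_contra! h
      exact hv (by ext i; fin_cases i <;> simp [h])
    · have := congrFun hv0 0
      simp [Matrix.mulVec, dotProduct, Fin.sum_univ_two] at this
      linarith
    · have := congrFun hv0 1
      simp [Matrix.mulVec, dotProduct, Fin.sum_univ_two] at this
      linarith
  obtain ⟨v0, v1, hv, e1, e2⟩ := eig l (by rw [← ht]; linear_combination hll)
  obtain ⟨w0, w1, hw, e3, e4⟩ := eig l⁻¹ (by rw [← ht]; linear_combination hll)
  -- If the two eigenvectors were proportional, the difference of the eigenvalues would annihilate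
  -- every product `vᵢ * wⱼ`.
  have hD : v0 * w1 - v1 * w0 ≠ 0 := by
    intro h
    have hne' := sub_ne_zero.2 hne
    have a1 : (l - l⁻¹) * (v0 * w1) = 0 := by
      linear_combination v0 * e4 - w0 * e2 - (A.1 1 1 - l) * h
    have a2 : (l - l⁻¹) * (v0 * w0) = 0 := by
      linear_combination v0 * e3 - w0 * e1 - A.1 0 1 * h
    have a3 : (l - l⁻¹) * (v1 * w1) = 0 := by
      linear_combination v1 * e4 - w1 * e2 + A.1 1 0 * h
    simp only [mul_eq_zero, hne', false_or] at a1 a2 a3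
    have a4 : v1 * w0 = 0 := by
      rcases a1 with a | a <;> simp [a] at h <;> simp [h]
    simp only [mul_eq_zero] at a4
    tauto
  set D := v0 * w1 - v1 * w0 with hDdef
  -- The columns are eigenvectors for `l` and `l⁻¹`, the second rescaled to give determinant `1`.
  have hdet : Matrix.det !![v0, w0 / D; v1, w1 / D] = 1 := by
    rw [Matrix.det_fin_two_of]
    field_simp
    rw [hDdef]; ring
  obtain ⟨g, hg⟩ : ∃ g : SL(2, ℝ), g.1 = !![v0, w0 / D; v1, w1 / D] := ⟨⟨_, hdet⟩, rfl⟩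
  refine ⟨l, hl, g, hl1, ?_⟩
  rw [eq_mul_inv_iff_mul_eq]
  ext i j
  rw [Matrix.SpecialLinearGroup.coe_mul, Matrix.SpecialLinearGroup.coe_mul, hg]
  fin_cases i <;> fin_cases j <;>
    simp [diagSL, Matrix.mul_apply, Fin.sum_univ_two] <;> field_simp <;>
    first | linarith | (rw [e3]; field_simp) | (rw [e4]; field_simp)

theorem diagSL_mul_self (l : ℝ) (hl : l ≠ 0) :
    diagSL l hl * diagSL l hl = diagSL (l * l) (mul_ne_zero hl hl) := by
  ext i j
  rw [Matrix.SpecialLinearGroup.coe_mul]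
  fin_cases i <;> fin_cases j <;> simp [diagSL, Matrix.mul_apply, Fin.sum_univ_two]

theorem diagSL_trace (l : ℝ) (hl : l ≠ 0) : (diagSL l hl).1.trace = l + l⁻¹ := by
  simp [diagSL]

theorem moebField_diagSL (l : ℝ) (hl : l ≠ 0) (z : ℂ) :
    moebField (diagSL l hl) z = ((l - l⁻¹ : ℝ) : ℂ) * z := by
  simp [moebField, diagSL]

/-- The vector field of a conjugate is the push-forward, the derivative of `g` at `z` being the
inverse square of its denominator. -/
theorem moebField_conj (g B : SL(2, ℝ)) (z : ℍ) :
    moebField (g * B * g⁻¹) ((g • z : ℍ) : ℂ) =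
      moebField B z / ((g.1 1 0 : ℂ) * z + g.1 1 1) ^ 2 := by
  have hn := SL2_denom_ne_zero g z
  have hd : ((g.1 0 0 : ℂ) * g.1 1 1 - g.1 0 1 * g.1 1 0) = 1 := by exact_mod_cast SL2_det g
  rw [SL2_coe_smul, moebField, moebField, eq_div_iff (pow_ne_zero 2 hn)]
  simp only [Matrix.SpecialLinearGroup.coe_mul, Matrix.SpecialLinearGroup.coe_inv,
    Matrix.adjugate_fin_two, Matrix.mul_apply, Fin.sum_univ_two, Matrix.of_apply,
    Matrix.cons_val', Matrix.cons_val_zero, Matrix.cons_val_one, Matrix.cons_val_fin_one]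
  push_cast
  generalize (g.1 0 0 : ℂ) = p at *
  generalize (g.1 0 1 : ℂ) = q at *
  generalize (g.1 1 0 : ℂ) = r at *
  generalize (g.1 1 1 : ℂ) = u at *
  have e : (p * z + q) / (r * z + u) * (r * z + u) = p * z + q := div_mul_cancel₀ _ hn
  generalize (p * z + q) / (r * z + u) = w at *
  have e2 : w ^ 2 * (r * z + u) ^ 2 = (p * z + q) ^ 2 := by rw [← mul_pow, e]
  generalize (B.1 0 0 : ℂ) = a at *
  generalize (B.1 0 1 : ℂ) = b at *
  generalize (B.1 1 0 : ℂ) = c at *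
  generalize (B.1 1 1 : ℂ) = d at *
  linear_combination ((p * a + q * c) * u - (p * b + q * d) * r
    - (-(r * a + u * c) * q + (r * b + u * d) * p)) * (r * z + u) * e
    - ((r * a + u * c) * u - (r * b + u * d) * r) * e2
    + (b + (a - d) * z - c * z ^ 2) * (p * u - q * r + 1) * hd

theorem SL2_trace_conj (g B : SL(2, ℝ)) : (g * B * g⁻¹).1.trace = B.1.trace := by
  rw [Matrix.SpecialLinearGroup.coe_mul, Matrix.trace_mul_comm,
    ← Matrix.SpecialLinearGroup.coe_mul, inv_mul_cancel_left]

theorem axisForm_conj_eq_zero_iff (g B : SL(2, ℝ)) (z : ℍ) :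
    axisForm (g * B * g⁻¹) (g • z) = 0 ↔ axisForm B z = 0 := by
  have h1 := normSq_moebField (g * B * g⁻¹) (g • z)
  have h2 := normSq_moebField B z
  have hn := SL2_denom_ne_zero g z
  have hn' : Complex.normSq ((g.1 1 0 : ℂ) * z + g.1 1 1) ≠ 0 := by simpa using hn
  rw [moebField_conj, SL2_trace_conj, SL2_im_smul, Complex.normSq_div, h2, map_pow] at h1
  have h3 : axisForm (g * B * g⁻¹) (g • z) ^ 2 =
      axisForm B z ^ 2 / Complex.normSq ((g.1 1 0 : ℂ) * z + g.1 1 1) ^ 2 := by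
    rw [eq_div_iff (pow_ne_zero 2 hn')]
    field_simp at h1
    linear_combination - h1
  constructor <;> intro h
  · rw [h] at h3
    have h4 := h3.symm
    simpa [hn'] using h4
  · rw [h] at h3
    simpa using h3

/-! ### Axes as geodesics and their tangent vectors -/

/-- The upward vertical geodesic through `I`. -/
noncomputable def vertGeod (t : ℝ) : ℍ := ⟨⟨0, Real.exp t⟩, Real.exp_pos t⟩

theorem isometry_vertGeod : Isometry vertGeod := isometry_vertical_line 0

theorem coe_vertGeod (t : ℝ) : (vertGeod t : ℂ) = Real.exp t * Complex.I := by
  apply Complex.ext <;> simp [vertGeod, -Complex.ofReal_exp]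

theorem diagSL_smul_vertGeod (l : ℝ) (hl : l ≠ 0) (t : ℝ) :
    diagSL l hl • vertGeod t = vertGeod (t + Real.log (l ^ 2)) := by
  apply UpperHalfPlane.ext
  rw [SL2_coe_smul, coe_vertGeod, coe_vertGeod, Real.exp_add, Real.exp_log (by positivity)]
  have : (l : ℂ) ≠ 0 := by exact_mod_cast hl
  simp [diagSL]
  field_simp

theorem exists_eq_vertGeod {z : ℍ} (hz : z.re = 0) : ∃ t, z = vertGeod t := by
  refine ⟨Real.log z.im, UpperHalfPlane.ext ?_⟩
  rw [coe_vertGeod, Real.exp_log z.im_pos]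
  apply Complex.ext <;> simp [hz]

theorem axisForm_diagSL (l : ℝ) (hl : l ≠ 0) (z : ℍ) :
    axisForm (diagSL l hl) z = -((l - l⁻¹) * z.re) := by
  simp [axisForm, diagSL]

theorem sub_inv_ne_zero {l : ℝ} (hl : l ≠ 0) (hl1 : 1 < l ^ 2) : l - l⁻¹ ≠ 0 := by
  intro h
  have := mul_inv_cancel₀ hl
  rw [← sub_eq_zero.1 h] at this
  nlinarith

/-- A geodesic translated by a diagonal matrix is the vertical one. -/
theorem eq_vertGeod_of_translated {l : ℝ} (hl : l ≠ 0) (hl1 : 1 < l ^ 2) {c : ℝ → ℍ}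
    (hc : Isometry c) {m : ℝ} (hm : 0 < m) (h : ∀ t, diagSL l hl • c t = c (t + m)) :
    ∃ s, ∀ t, c t = vertGeod (t + s) := by
  -- On the geodesic the matrix moves points by `m` and its square by `2 * m`. The duplication
  -- formula for `sinh` then gives `4 * cosh² (m / 2) = (l + l⁻¹)²`, the least displacement, which
  -- is attained only for real part `0`.
  have hre : ∀ t, (c t).re = 0 := by
    intro t
    have h1 := sinh_half_dist_smul_sq (diagSL l hl) (c t)
    have h2 := sinh_half_dist_smul_sq (diagSL (l * l) (mul_ne_zero hl hl)) (c t)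
    rw [h, hc.dist_eq, Real.dist_eq, moebField_diagSL] at h1
    rw [← diagSL_mul_self l hl, mul_smul, h, h, hc.dist_eq, Real.dist_eq, diagSL_mul_self,
      moebField_diagSL] at h2
    have e1 : |t - (t + m)| / 2 = m / 2 := by
      rw [show t - (t + m) = -m by ring, abs_neg, abs_of_pos hm]
    have e2 : |t - (t + m + m)| / 2 = 2 * (m / 2) := by
      rw [show t - (t + m + m) = -(2 * m) by ring, abs_neg, abs_of_pos (by linarith)]
      ring
    have hy := (c t).im_pos
    rw [e1, Complex.normSq_mul, Complex.normSq_ofReal, Complex.normSq_apply] at h1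
    rw [e2, Real.sinh_two_mul, Complex.normSq_mul, Complex.normSq_ofReal,
      Complex.normSq_apply] at h2
    rw [UpperHalfPlane.coe_re, UpperHalfPlane.coe_im] at h1 h2
    have hs : 0 < Real.sinh (m / 2) := Real.sinh_pos_iff.2 (by linarith)
    have hcs := Real.cosh_sq (m / 2)
    set S := Real.sinh (m / 2)
    set C := Real.cosh (m / 2)
    set N := ((c t).re * (c t).re + (c t).im * (c t).im) / (4 * (c t).im ^ 2) with hN
    have h1' : S ^ 2 = (l - l⁻¹) ^ 2 * N := by rw [h1, hN]; ring
    have h2' : (2 * S * C) ^ 2 = (l - l⁻¹) ^ 2 * (l + l⁻¹) ^ 2 * N := by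
      rw [h2, hN, mul_inv]; ring
    have h3 : S ^ 2 * (4 * C ^ 2 - (l + l⁻¹) ^ 2) = 0 := by
      linear_combination h2' - (l + l⁻¹) ^ 2 * h1'
    have h4 : 4 * C ^ 2 - (l + l⁻¹) ^ 2 = 0 := by
      rcases mul_eq_zero.1 h3 with h | h
      · exact absurd h (pow_pos hs 2).ne'
      · exact h
    have hll := mul_inv_cancel₀ hl
    have h5 : (l - l⁻¹) ^ 2 * (4 * N - 1) = 0 := by
      linear_combination h4 - 4 * h1' - 4 * hcs + 4 * hll
    have h6 : 4 * N = 1 := by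
      rcases mul_eq_zero.1 h5 with h | h
      · exact absurd h (pow_ne_zero 2 (sub_inv_ne_zero hl hl1))
      · linarith
    rw [hN] at h6
    field_simp at h6
    have h7 : (c t).re ^ 2 = 0 := by linarith
    exact pow_eq_zero_iff two_ne_zero |>.1 h7
  choose f hf using fun t => exists_eq_vertGeod (hre t)
  have hd : ∀ s t, |f s - f t| = |s - t| := by
    intro s t
    rw [← Real.dist_eq, ← Real.dist_eq, ← isometry_vertGeod.dist_eq, ← hf, ← hf, hc.dist_eq]
  have hfm : f m = f 0 + Real.log (l ^ 2) := by
    apply isometry_vertGeod.injective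
    rw [← hf, ← diagSL_smul_vertGeod l hl, ← hf, h, zero_add]
  have hlog := Real.log_pos hl1
  -- `f` is an isometric map of the line; moving `0` in the positive direction towards `f m`
  -- excludes the reflection.
  have hm' : f m - f 0 = m := by
    have h1 := hd m 0
    rw [sub_zero, abs_of_pos hm, abs_of_pos (by linarith)] at h1
    exact h1
  refine ⟨f 0, fun t => ?_⟩
  rw [hf t]
  congr 1
  have h1 := hd t 0
  have h2 := hd t m
  rw [sub_zero, abs_eq_abs] at h1
  rw [abs_eq_abs] at h2
  rcases h1 with h1 | h1 <;> rcases h2 with h2 | h2 <;> linarith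

theorem hasDerivAt_SL2_smul (g : SL(2, ℝ)) {c : ℝ → ℍ} {v : ℂ} {t : ℝ}
    (hc : HasDerivAt (fun t => (c t : ℂ)) v t) :
    HasDerivAt (fun t => ((g • c t : ℍ) : ℂ)) (v / ((g.1 1 0 : ℂ) * c t + g.1 1 1) ^ 2) t := by
  have hn := SL2_denom_ne_zero g (c t)
  have hd : ((g.1 0 0 : ℂ) * g.1 1 1 - g.1 0 1 * g.1 1 0) = 1 := by exact_mod_cast SL2_det g
  simp only [SL2_coe_smul]
  refine (((hc.const_mul (g.1 0 0 : ℂ)).add_const (g.1 0 1 : ℂ)).div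
    ((hc.const_mul (g.1 1 0 : ℂ)).add_const (g.1 1 1 : ℂ)) hn).congr_deriv ?_
  congr 1
  linear_combination v * hd

theorem hasDerivAt_vertGeod (t : ℝ) :
    HasDerivAt (fun t => (vertGeod t : ℂ)) (vertGeod t : ℂ) t := by
  simp only [coe_vertGeod]
  exact (Real.hasDerivAt_exp t).ofReal_comp.mul_const Complex.I

/-- The geodesic `t ↦ vertGeod (t + s)` has unit tangent vector given by `moebField`. -/
theorem hasDerivAt_smul_vertGeod (g : SL(2, ℝ)) {l : ℝ} (hl : l ≠ 0) (hl1 : 1 < l ^ 2) (s : ℝ) :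
    let A := g * diagSL l hl * g⁻¹
    ∃ v : ℂ, HasDerivAt (fun t => ((g • vertGeod (t + s) : ℍ) : ℂ)) v 0 ∧
      v * √(A.1.trace ^ 2 * (A.1.trace ^ 2 - 4)) =
        A.1.trace * moebField A ((g • vertGeod s : ℍ) : ℂ) := by
  intro A
  have h0 : HasDerivAt (fun t : ℝ => (vertGeod (t + s) : ℂ)) (vertGeod s) 0 := by
    have := hasDerivAt_vertGeod (0 + s)
    rw [zero_add] at this
    exact HasDerivAt.comp_add_const (x := 0) (a := s) (by simpa using this)
  refine ⟨_, hasDerivAt_SL2_smul g h0, ?_⟩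
  rw [moebField_conj, SL2_trace_conj, diagSL_trace, moebField_diagSL, zero_add]
  have hll := mul_inv_cancel₀ hl
  -- This is `l² - l⁻² ≥ 0` for either sign of `l`: the factor `tr A` corrects the sign of `l -
  -- l⁻¹`.
  have hpos : 0 ≤ (l + l⁻¹) * (l - l⁻¹) := by
    have h2 : l⁻¹ ^ 2 < 1 := by
      rw [inv_pow]
      exact inv_lt_one_of_one_lt₀ hl1
    nlinarith
  have : (l + l⁻¹) ^ 2 * ((l + l⁻¹) ^ 2 - 4) = ((l + l⁻¹) * (l - l⁻¹)) ^ 2 := by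
    linear_combination 4 * (l + l⁻¹) ^ 2 * hll
  rw [this, Real.sqrt_sq hpos]
  push_cast
  ring

/-- An axis of `A` consists of zeros of `axisForm A`, and `moebField A` gives its tangent vectors. -/
theorem tangent_of_translated {A : SL(2, ℝ)} (hA : 4 < A.1.trace ^ 2) {c : ℝ → ℍ}
    (hc : Isometry c) {m : ℝ} (hm : 0 < m) (h : ∀ t, A • c t = c (t + m)) {v : ℂ}
    (hv : HasDerivAt (fun t => (c t : ℂ)) v 0) :
    axisForm A (c 0) = 0 ∧
      v * √(A.1.trace ^ 2 * (A.1.trace ^ 2 - 4)) = A.1.trace * moebField A (c 0) := by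
  obtain ⟨l, hl, g, hl1, rfl⟩ := exists_conj_diagSL A hA
  obtain ⟨s, hs⟩ := eq_vertGeod_of_translated hl hl1 (c := fun t => g⁻¹ • c t)
    ((isometry_smul ℍ g⁻¹).comp hc) hm (by
      intro t
      rw [← h t, mul_smul, mul_smul, inv_smul_smul])
  have hs' : ∀ t, c t = g • vertGeod (t + s) := fun t => by rw [← hs, smul_inv_smul]
  obtain ⟨w, hw, hw2⟩ := hasDerivAt_smul_vertGeod g hl hl1 s
  simp only [hs'] at hv ⊢
  rw [zero_add]
  refine ⟨?_, ?_⟩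
  · rw [axisForm_conj_eq_zero_iff, axisForm_diagSL]
    simp [vertGeod]
  · rw [hv.unique hw, hw2]

/-- Through every zero of `axisForm A` there is a geodesic translated by `A`. -/
theorem exists_translated {A : SL(2, ℝ)} (hA : 4 < A.1.trace ^ 2) {z : ℍ}
    (hz : axisForm A z = 0) :
    ∃ (c : ℝ → ℍ) (m : ℝ) (v : ℂ), Isometry c ∧ 0 < m ∧ (∀ t, A • c t = c (t + m)) ∧ c 0 = z ∧
      HasDerivAt (fun t => (c t : ℂ)) v 0 := by
  obtain ⟨l, hl, g, hl1, rfl⟩ := exists_conj_diagSL A hA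
  obtain ⟨w, rfl⟩ : ∃ w, z = g • w := ⟨g⁻¹ • z, (smul_inv_smul g z).symm⟩
  rw [axisForm_conj_eq_zero_iff, axisForm_diagSL, neg_eq_zero, mul_eq_zero,
    or_iff_right (sub_inv_ne_zero hl hl1)] at hz
  obtain ⟨s, rfl⟩ := exists_eq_vertGeod hz
  obtain ⟨v, hv, -⟩ := hasDerivAt_smul_vertGeod g hl hl1 s
  refine ⟨fun t => g • vertGeod (t + s), Real.log (l ^ 2), v, ?_, Real.log_pos hl1, ?_, ?_, hv⟩
  · exact (isometry_smul ℍ g).comp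
      (isometry_vertGeod.comp (IsometryEquiv.addRight s).isometry)
  · intro t
    rw [mul_smul, mul_smul, inv_smul_smul, diagSL_smul_vertGeod]
    congr 2
    ring
  · simp

theorem exists_axisForm_eq_zero {A : SL(2, ℝ)} (hA : 4 < A.1.trace ^ 2) :
    ∃ z : ℍ, axisForm A z = 0 := by
  obtain ⟨l, hl, g, hl1, rfl⟩ := exists_conj_diagSL A hA
  exact ⟨g • vertGeod 0, by rw [axisForm_conj_eq_zero_iff, axisForm_diagSL]; simp [vertGeod]⟩

/-! ### Cosine and sine of the angle as matrix invariants -/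

/-- `tr M * tr N` times the polarized discriminant of the characteristic polynomials. -/
def crossForm (M N : Fin 2 → Fin 2 → ℝ) : ℝ :=
  (M 0 0 + M 1 1) * (N 0 0 + N 1 1) *
    ((M 0 0 - M 1 1) * (N 0 0 - N 1 1) + 2 * M 0 1 * N 1 0 + 2 * M 1 0 * N 0 1)

/-- `tr M * tr N` times the lower left entry of the commutator of `M` and `N`. -/
def crossSign (M N : Fin 2 → Fin 2 → ℝ) : ℝ :=
  (M 0 0 + M 1 1) * (N 0 0 + N 1 1) * (M 1 0 * (N 0 0 - N 1 1) - N 1 0 * (M 0 0 - M 1 1))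

/-- For `M` in `SL(2, ℝ)`, the square of `λ² - λ⁻²` where `λ` is an eigenvalue. -/
def axisNormSq (M : Fin 2 → Fin 2 → ℝ) : ℝ :=
  (M 0 0 + M 1 1) ^ 2 * ((M 0 0 + M 1 1) ^ 2 - 4)

/-- The cosine of the angle between the oriented axes of `M` and `N`. -/
noncomputable def angleCos (M N : Fin 2 → Fin 2 → ℝ) : ℝ :=
  crossForm M N / √(axisNormSq M * axisNormSq N)

/-- The angle between the oriented axes of `M` and `N`. -/
noncomputable def angleFormula (M N : Fin 2 → Fin 2 → ℝ) : ℝ :=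
  if 0 ≤ crossSign M N then Real.arccos (angleCos M N)
  else 2 * Real.pi - Real.arccos (angleCos M N)

theorem axisNormSq_pos {A : SL(2, ℝ)} (hA : 4 < A.1.trace ^ 2) : 0 < axisNormSq A.1 := by
  rw [SL2_trace] at hA
  unfold axisNormSq
  have : 0 < (A.1 0 0 + A.1 1 1) ^ 2 - 4 := by linarith
  have : 0 < (A.1 0 0 + A.1 1 1) ^ 2 := by linarith
  positivity

/-- The zero conditions eliminate the upper right entries. What remains has the cosine as real part
and the sine as imaginary part, up to common positive factors. -/
theorem moebField_mul_conj {A B : SL(2, ℝ)} {z : ℍ} (hA : axisForm A z = 0)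
    (hB : axisForm B z = 0) :
    (A.1.trace * B.1.trace : ℂ) * (moebField B z * conj (moebField A z)) =
      (z.im : ℂ) ^ 2 * (crossForm A.1 B.1 + 2 * z.im * crossSign A.1 B.1 * Complex.I) := by
  unfold axisForm at hA hB
  simp only [SL2_trace, moebField, crossForm, crossSign]
  have ha : A.1 0 1 = A.1 1 0 * (z.re ^ 2 + z.im ^ 2) - (A.1 0 0 - A.1 1 1) * z.re := by linarith
  have hb : B.1 0 1 = B.1 1 0 * (z.re ^ 2 + z.im ^ 2) - (B.1 0 0 - B.1 1 1) * z.re := by linarith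
  have hz : (z : ℂ) = z.re + z.im * Complex.I := (Complex.re_add_im (z : ℂ)).symm
  rw [ha, hb, hz]
  simp only [map_add, map_sub, map_mul, map_pow, Complex.conj_ofReal, Complex.conj_I]
  push_cast
  have hI := Complex.I_sq
  generalize (A.1 0 0 : ℂ) = p
  generalize (A.1 1 0 : ℂ) = r
  generalize (A.1 1 1 : ℂ) = u
  generalize (B.1 0 0 : ℂ) = p'
  generalize (B.1 1 0 : ℂ) = r'
  generalize (B.1 1 1 : ℂ) = u'
  generalize (z.re : ℂ) = x
  generalize (z.im : ℂ) = y
  have e1 : r' * (x ^ 2 + y ^ 2) - (p' - u') * x + (p' - u') * (x + y * Complex.I) -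
      r' * (x + y * Complex.I) ^ 2 = 2 * r' * y ^ 2 + y * (p' - u' - 2 * r' * x) * Complex.I := by
    linear_combination (-r' * y ^ 2) * hI
  have e2 : r * (x ^ 2 + y ^ 2) - (p - u) * x + (p - u) * (x + y * -Complex.I) -
      r * (x + y * -Complex.I) ^ 2 = 2 * r * y ^ 2 - y * (p - u - 2 * r * x) * Complex.I := by
    linear_combination (-r * y ^ 2) * hI
  rw [e1, e2]
  linear_combination (-(p + u) * (p' + u') * y ^ 2 * (p' - u' - 2 * r' * x) *
    (p - u - 2 * r * x)) * hI

/-- The unit tangent vectors at a common point of the two axes differ by the unit complex number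
which is determined by the invariants of the two matrices. -/
theorem tangent_eq_mul_iff {A B : SL(2, ℝ)} (hA : 4 < A.1.trace ^ 2) (hB : 4 < B.1.trace ^ 2)
    {z : ℍ} (hzA : axisForm A z = 0) (hzB : axisForm B z = 0) {v w : ℂ}
    (hv : v * √(A.1.trace ^ 2 * (A.1.trace ^ 2 - 4)) = A.1.trace * moebField A z)
    (hw : w * √(B.1.trace ^ 2 * (B.1.trace ^ 2 - 4)) = B.1.trace * moebField B z) (e : ℂ) :
    w = e * v ↔ e * √(axisNormSq A.1 * axisNormSq B.1) =
      crossForm A.1 B.1 + 2 * z.im * crossSign A.1 B.1 * Complex.I := by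
  have pA := axisNormSq_pos hA
  have pB := axisNormSq_pos hB
  have hcross := moebField_mul_conj hzA hzB
  have hself : moebField A z * conj (moebField A z) = z.im ^ 2 * (A.1.trace ^ 2 - 4) := by
    rw [Complex.mul_conj, normSq_moebField, hzA]
    push_cast
    ring
  have eA : A.1.trace ^ 2 * (A.1.trace ^ 2 - 4) = axisNormSq A.1 := by
    rw [SL2_trace]; rfl
  have eB : B.1.trace ^ 2 * (B.1.trace ^ 2 - 4) = axisNormSq B.1 := by
    rw [SL2_trace]; rfl
  have eA' : (A.1.trace : ℂ) ^ 2 * ((A.1.trace : ℂ) ^ 2 - 4) = axisNormSq A.1 := by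
    exact_mod_cast eA
  rw [eA] at hv
  rw [eB] at hw
  rw [Real.sqrt_mul pA.le]
  push_cast
  have hS : (√(axisNormSq A.1) : ℂ) ^ 2 = axisNormSq A.1 := by
    exact_mod_cast Real.sq_sqrt pA.le
  have hS0 : (√(axisNormSq A.1) : ℂ) ≠ 0 := by exact_mod_cast (Real.sqrt_pos.2 pA).ne'
  have hT0 : (√(axisNormSq B.1) : ℂ) ≠ 0 := by exact_mod_cast (Real.sqrt_pos.2 pB).ne'
  have hy : (z.im : ℂ) ≠ 0 := by exact_mod_cast z.im_pos.ne'
  have hv' : conj v * √(axisNormSq A.1) = A.1.trace * conj (moebField A z) := by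
    have := congrArg conj hv
    simpa using this
  generalize (√(axisNormSq A.1) : ℂ) = S at *
  generalize (√(axisNormSq B.1) : ℂ) = T at *
  -- Unit speed in the hyperbolic metric means Euclidean length `z.im`.
  have h1 : v * conj v = z.im ^ 2 := by
    apply mul_right_cancel₀ (pow_ne_zero 2 hS0)
    linear_combination conj v * S * hv + A.1.trace * moebField A z * hv' +
      (A.1.trace : ℂ) ^ 2 * hself + (z.im : ℂ) ^ 2 * (eA' - hS)
  have h2 : w * conj v * (S * T) =
      z.im ^ 2 * (crossForm A.1 B.1 + 2 * z.im * crossSign A.1 B.1 * Complex.I) := by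
    linear_combination conj v * S * hw + B.1.trace * moebField B z * hv' + hcross
  have hv0 : conj v ≠ 0 := by
    intro h
    rw [h, mul_zero] at h1
    exact pow_ne_zero 2 hy h1.symm
  constructor
  · intro h
    apply mul_left_cancel₀ (pow_ne_zero 2 hy)
    rw [← h2, h, ← h1]
    ring
  · intro h
    rw [← h] at h2
    apply mul_right_cancel₀ hv0
    apply mul_right_cancel₀ (mul_ne_zero hS0 hT0)
    rw [h2, ← h1]
    ring

theorem isIntersectionAngle_iff {G : Type*} [Group G] (ρ : SurfaceRep G) {a b : G}
    {A B : SL(2, ℝ)} (hA : QuotientGroup.mk A = ρ.1 a) (hB : QuotientGroup.mk B = ρ.1 b)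
    (hA4 : 4 < A.1.trace ^ 2) (hB4 : 4 < B.1.trace ^ 2) (θ : ℝ) :
    IsIntersectionAngle ρ a b θ ↔ 0 ≤ θ ∧ θ < 2 * Real.pi ∧
      ∃ z : ℍ, axisForm A z = 0 ∧ axisForm B z = 0 ∧
        Real.cos θ * √(axisNormSq A.1 * axisNormSq B.1) = crossForm A.1 B.1 ∧
        Real.sin θ * √(axisNormSq A.1 * axisNormSq B.1) = 2 * z.im * crossSign A.1 B.1 := by
  have key : ∀ y : ℝ, Complex.exp (θ * Complex.I) * √(axisNormSq A.1 * axisNormSq B.1) =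
      crossForm A.1 B.1 + 2 * y * crossSign A.1 B.1 * Complex.I ↔
      Real.cos θ * √(axisNormSq A.1 * axisNormSq B.1) = crossForm A.1 B.1 ∧
        Real.sin θ * √(axisNormSq A.1 * axisNormSq B.1) = 2 * y * crossSign A.1 B.1 := by
    intro y
    rw [Complex.exp_mul_I, ← Complex.ofReal_cos, ← Complex.ofReal_sin, Complex.ext_iff]
    simp [-Complex.ofReal_cos, -Complex.ofReal_sin]
  unfold IsIntersectionAngle
  refine and_congr_right fun _ => and_congr_right fun _ => ⟨?_, ?_⟩
  · rintro ⟨c, c', ⟨hc, m, hm, hcm⟩, ⟨hc', m', hm', hcm'⟩, h0, v, w, hv, hw, hvw⟩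
    rw [← hA] at hcm
    rw [← hB] at hcm'
    obtain ⟨x1, x2⟩ := tangent_of_translated hA4 hc hm hcm hv
    obtain ⟨y1, y2⟩ := tangent_of_translated hB4 hc' hm' hcm' hw
    rw [← h0] at y1 y2
    exact ⟨c 0, x1, y1, (key _).1 ((tangent_eq_mul_iff hA4 hB4 x1 y1 x2 y2 _).1 hvw)⟩
  · rintro ⟨z, x1, y1, h⟩
    obtain ⟨c, m, v, hc, hm, hcm, hcz, hv⟩ := exists_translated hA4 x1
    obtain ⟨c', m', w, hc', hm', hcm', hcz', hw⟩ := exists_translated hB4 y1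
    have x2 := (tangent_of_translated hA4 hc hm hcm hv).2
    have y2 := (tangent_of_translated hB4 hc' hm' hcm' hw).2
    rw [hcz] at x2
    rw [hcz'] at y2
    refine ⟨c, c', ⟨hc, m, hm, ?_⟩, ⟨hc', m', hm', ?_⟩, hcz.trans hcz'.symm, v, w, hv, hw,
      (tangent_eq_mul_iff hA4 hB4 x1 y1 x2 y2 _).2 ((key _).2 h)⟩
    · rw [← hA]; exact hcm
    · rw [← hB]; exact hcm'

/-- The height `y` enters only through its sign: an angle in `[0, 2π)` is fixed by its cosine and
the half-plane in which its sine lies. -/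
theorem eq_angleFormula {A B : SL(2, ℝ)} (hA : 4 < A.1.trace ^ 2) (hB : 4 < B.1.trace ^ 2)
    {θ y : ℝ} (h0 : 0 ≤ θ) (h1 : θ < 2 * Real.pi) (hy : 0 < y)
    (hcos : Real.cos θ * √(axisNormSq A.1 * axisNormSq B.1) = crossForm A.1 B.1)
    (hsin : Real.sin θ * √(axisNormSq A.1 * axisNormSq B.1) = 2 * y * crossSign A.1 B.1) :
    θ = angleFormula A.1 B.1 := by
  have hS : 0 < √(axisNormSq A.1 * axisNormSq B.1) :=
    Real.sqrt_pos.2 (mul_pos (axisNormSq_pos hA) (axisNormSq_pos hB))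
  have hc : angleCos A.1 B.1 = Real.cos θ := by
    unfold angleCos
    rw [← hcos, mul_div_cancel_right₀ _ hS.ne']
  unfold angleFormula
  rw [hc]
  split_ifs with h
  · have hs : 0 ≤ Real.sin θ := by
      by_contra! hlt
      have := mul_neg_of_neg_of_pos hlt hS
      have : 0 ≤ 2 * y * crossSign A.1 B.1 := by positivity
      linarith
    have hle : θ ≤ Real.pi := by
      by_contra! hlt
      have := Real.sin_pos_of_pos_of_lt_pi (x := θ - Real.pi) (by linarith) (by linarith)
      rw [Real.sin_sub_pi] at this
      linarith
    rw [Real.arccos_cos h0 hle]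
  · have hs : Real.sin θ < 0 := by
      by_contra! hle
      have := mul_nonneg hle hS.le
      have := mul_neg_of_pos_of_neg (show 0 < 2 * y by linarith) (not_le.1 h)
      linarith
    have hle : Real.pi < θ := by
      by_contra! hlt
      have := Real.sin_nonneg_of_nonneg_of_le_pi h0 hlt
      linarith
    rw [← Real.cos_two_pi_sub, Real.arccos_cos (by linarith) (by linarith)]
    ring

/-! ### The commutator trace and crossing of axes -/

theorem two_sub_trace_commutator (A B : SL(2, ℝ)) :
    2 - (A * B * A⁻¹ * B⁻¹).1.trace =
      -(A.1 0 1 * B.1 1 0 - B.1 0 1 * A.1 1 0) ^ 2 -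
        ((A.1 0 0 - A.1 1 1) * B.1 0 1 - (B.1 0 0 - B.1 1 1) * A.1 0 1) *
        (A.1 1 0 * (B.1 0 0 - B.1 1 1) - B.1 1 0 * (A.1 0 0 - A.1 1 1)) := by
  have hA := SL2_det A
  have hB := SL2_det B
  rw [SL2_trace]
  simp only [Matrix.SpecialLinearGroup.coe_mul, Matrix.SpecialLinearGroup.coe_inv,
    Matrix.adjugate_fin_two, Matrix.mul_apply, Fin.sum_univ_two, Matrix.of_apply,
    Matrix.cons_val', Matrix.cons_val_zero, Matrix.cons_val_one, Matrix.cons_val_fin_one]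
  linear_combination (-2 * (B.1 0 0 * B.1 1 1 - B.1 0 1 * B.1 1 0)) * hA - 2 * hB

/-- Dividing by the two norms turns the left side into `1 - cos²`, hence the formula for `sin²` and
the bound on the cosine. -/
theorem crossForm_sq (A B : SL(2, ℝ)) :
    axisNormSq A.1 * axisNormSq B.1 - crossForm A.1 B.1 ^ 2 =
      A.1.trace ^ 2 * B.1.trace ^ 2 * (4 * (2 - (A * B * A⁻¹ * B⁻¹).1.trace)) := by
  have hA := SL2_det A
  have hB := SL2_det B
  rw [two_sub_trace_commutator, SL2_trace, SL2_trace]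
  unfold axisNormSq crossForm
  linear_combination (A.1 0 0 + A.1 1 1) ^ 2 * (B.1 0 0 + B.1 1 1) ^ 2 *
    (4 * ((B.1 0 0 + B.1 1 1) ^ 2 - 4) * hA +
      4 * ((A.1 0 0 - A.1 1 1) ^ 2 + 4 * A.1 0 1 * A.1 1 0) * hB)

/-- In this form the invariance under conjugation and under changes of sign of the lifts is visible.
-/
theorem crossForm_eq_trace (A B : SL(2, ℝ)) :
    crossForm A.1 B.1 =
      A.1.trace * B.1.trace * (2 * (A * B).1.trace - A.1.trace * B.1.trace) := by
  rw [SL2_trace, SL2_trace, SL2_trace]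
  simp only [Matrix.SpecialLinearGroup.coe_mul, Matrix.mul_apply, Fin.sum_univ_two, crossForm]
  ring

/-- If the trace of the commutator is less than `2`, the axes cross. -/
theorem exists_axisForm_eq_zero_of_lt {A B : SL(2, ℝ)}
    (h : 0 < 2 - (A * B * A⁻¹ * B⁻¹).1.trace) :
    A.1 1 0 * (B.1 0 0 - B.1 1 1) - B.1 1 0 * (A.1 0 0 - A.1 1 1) ≠ 0 ∧
    ∃ z : ℍ, axisForm A z = 0 ∧ axisForm B z = 0 := by
  have hD := two_sub_trace_commutator A B
  set D := 2 - (A * B * A⁻¹ * B⁻¹).1.trace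
  set R := A.1 1 0 * (B.1 0 0 - B.1 1 1) - B.1 1 0 * (A.1 0 0 - A.1 1 1) with hR
  set P := A.1 0 1 * B.1 1 0 - B.1 0 1 * A.1 1 0 with hP
  have hR0 : R ≠ 0 := by
    intro h0
    rw [h0, mul_zero, sub_zero] at hD
    nlinarith [sq_nonneg P]
  -- Eliminating `|z|²` from the two axis equations gives `x = P / R`, and then `y² = D / R²`.
  refine ⟨hR0, ⟨⟨P / R, √D / |R|⟩, div_pos (Real.sqrt_pos.2 h) (abs_pos.2 hR0)⟩, ?_, ?_⟩
  · change A.1 1 0 * ((P / R) ^ 2 + (√D / |R|) ^ 2) - (A.1 0 0 - A.1 1 1) * (P / R) - A.1 0 1 = 0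
    rw [div_pow, div_pow, sq_abs, Real.sq_sqrt h.le, hD]
    field_simp
    rw [hP, hR]
    ring
  · change B.1 1 0 * ((P / R) ^ 2 + (√D / |R|) ^ 2) - (B.1 0 0 - B.1 1 1) * (P / R) - B.1 0 1 = 0
    rw [div_pow, div_pow, sq_abs, Real.sq_sqrt h.le, hD]
    field_simp
    rw [hP, hR]
    ring

theorem commute_entries {A B : SL(2, ℝ)} (h : A * B = B * A) :
    A.1 0 1 * B.1 1 0 - B.1 0 1 * A.1 1 0 = 0 ∧
    (A.1 0 0 - A.1 1 1) * B.1 0 1 - (B.1 0 0 - B.1 1 1) * A.1 0 1 = 0 ∧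
    A.1 1 0 * (B.1 0 0 - B.1 1 1) - B.1 1 0 * (A.1 0 0 - A.1 1 1) = 0 := by
  have h' : ∀ i j, (A * B).1 i j = (B * A).1 i j := fun i j => by rw [h]
  have h00 := h' 0 0
  have h01 := h' 0 1
  have h10 := h' 1 0
  simp only [Matrix.SpecialLinearGroup.coe_mul, Matrix.mul_apply, Fin.sum_univ_two] at h00 h01 h10
  refine ⟨?_, ?_, ?_⟩ <;> linarith

/-- Commuting hyperbolic elements have the same axis. -/
theorem axisForm_eq_zero_of_commute {A B : SL(2, ℝ)} (hA : 4 < A.1.trace ^ 2) (h : A * B = B * A)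
    {z : ℍ} (hz : axisForm A z = 0) : axisForm B z = 0 := by
  obtain ⟨hP, hQ, hR⟩ := commute_entries h
  have hd := SL2_det A
  rw [SL2_trace] at hA
  unfold axisForm at *
  set x := z.re
  set n := x ^ 2 + z.im ^ 2
  set H := B.1 1 0 * n - (B.1 0 0 - B.1 1 1) * x - B.1 0 1
  -- `H` is annihilated by the entries `c` and `a - d` of `A`, hence by the discriminant `(a - d)² +
  -- 4bc = tr² - 4`, which is positive.
  have e1 : H * A.1 1 0 = 0 := by
    linear_combination (-x) * hR + B.1 1 0 * hz + hP
  have e2 : H * (A.1 0 0 - A.1 1 1) = 0 := by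
    linear_combination (-n) * hR + (B.1 0 0 - B.1 1 1) * hz - hQ
  have e3 : H * ((A.1 0 0 + A.1 1 1) ^ 2 - 4) = 0 := by
    linear_combination (A.1 0 0 - A.1 1 1) * e2 + 4 * A.1 0 1 * e1 + 4 * H * hd
  exact (mul_eq_zero.1 e3).resolve_right (by linarith)

/-! ### Invariants on the space of conjugacy classes -/

theorem PSL_mk_eq_mk {A B : SL(2, ℝ)}
    (h : (QuotientGroup.mk A : PSL(2, ℝ)) = QuotientGroup.mk B) : B = A ∨ B = -A := by
  rw [QuotientGroup.eq, Matrix.SpecialLinearGroup.mem_center_iff] at h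
  obtain ⟨r, hr, hs⟩ := h
  rw [Fintype.card_fin] at hr
  have hB : B.1 = A.1 * Matrix.scalar (Fin 2) r := by
    rw [hs, ← Matrix.SpecialLinearGroup.coe_mul, mul_inv_cancel_left]
  rcases eq_or_eq_neg_of_sq_eq_sq r 1 (by rw [hr, one_pow]) with h | h
  · left; apply Subtype.ext; rw [hB, h, map_one, mul_one]
  · right; apply Subtype.ext; rw [hB, h, map_neg, map_one, mul_neg, mul_one]; rfl

/-- A continuous invariant of pairs of matrices descends to conjugacy classes of
representations. -/
theorem exists_continuous_descent {G : Type*} [Group G] (a b : G)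
    (f : SL(2, ℝ) × SL(2, ℝ) → ℝ) (hf : Continuous f)
    (hl : ∀ A B, f (-A, B) = f (A, B)) (hr : ∀ A B, f (A, -B) = f (A, B))
    (hc : ∀ g A B, f (g * A * g⁻¹, g * B * g⁻¹) = f (A, B)) :
    ∃ F : RepClasses G → ℝ, Continuous F ∧ ∀ (ρ : SurfaceRep G) (A B : SL(2, ℝ)),
      QuotientGroup.mk A = ρ.1 a → QuotientGroup.mk B = ρ.1 b → F (repClass ρ) = f (A, B) := by
  have hinv : ∀ A B A' B' : SL(2, ℝ), (QuotientGroup.mk A : PSL(2, ℝ)) = QuotientGroup.mk A' →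
      (QuotientGroup.mk B : PSL(2, ℝ)) = QuotientGroup.mk B' → f (A', B') = f (A, B) := by
    intro A B A' B' h h'
    rcases PSL_mk_eq_mk h with rfl | rfl <;> rcases PSL_mk_eq_mk h' with rfl | rfl <;>
      simp only [hl, hr]
  -- The chosen lifts do not matter, because lifts are unique up to sign and `f` ignores signs.
  let fP : PSL(2, ℝ) × PSL(2, ℝ) → ℝ := fun p => f (p.1.out, p.2.out)
  have hfP : ∀ A B : SL(2, ℝ), fP (QuotientGroup.mk A, QuotientGroup.mk B) = f (A, B) :=
    fun A B => hinv _ _ _ _ (QuotientGroup.out_eq' _).symm (QuotientGroup.out_eq' _).symm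
  have hcont : Continuous fP := by
    have hq := ((QuotientGroup.isOpenQuotientMap_mk (N := Subgroup.center SL(2, ℝ))).prodMap
      (QuotientGroup.isOpenQuotientMap_mk (N := Subgroup.center SL(2, ℝ)))).isQuotientMap
    rw [hq.continuous_iff]
    exact hf.congr fun p => (hfP p.1 p.2).symm
  have hev : ∀ g : G, Continuous fun ρ : SurfaceRep G => ρ.1 g :=
    fun g => (continuous_apply g).comp continuous_induced_dom
  refine ⟨Quotient.lift (fun ρ : SurfaceRep G => fP (ρ.1 a, ρ.1 b)) ?_, ?_, ?_⟩
  · rintro ρ σ ⟨h, hh⟩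
    obtain ⟨g, rfl⟩ := QuotientGroup.mk_surjective h
    obtain ⟨A, hA⟩ := QuotientGroup.mk_surjective (ρ.1 a)
    obtain ⟨B, hB⟩ := QuotientGroup.mk_surjective (ρ.1 b)
    rw [hh, hh, ← hA, ← hB, hfP, ← hc g]
    exact (hfP _ _).symm
  · exact (hcont.comp ((hev a).prodMk (hev b))).quotient_lift _
  · intro ρ A B hA hB
    change fP (ρ.1 a, ρ.1 b) = _
    rw [← hA, ← hB, hfP]

/-- A continuous nowhere vanishing function has constant sign on Teichmüller space. -/
theorem Teich_pos_of_ne_zero {G : Type*} [Group G] {ρ₀ : SurfaceRep G} {F : RepClasses G → ℝ}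
    (hF : Continuous F) (hne : ∀ x, F x ≠ 0) (h0 : 0 < F (repClass ρ₀)) {x : RepClasses G}
    (hx : x ∈ Teich ρ₀) : 0 < F x := by
  have hclopen : IsClopen {x | 0 < F x} := by
    refine ⟨?_, isOpen_lt continuous_const hF⟩
    have : {x | 0 < F x} = {x | 0 ≤ F x} := by
      ext x
      exact ⟨fun h => le_of_lt (α := ℝ) h, fun h => lt_of_le_of_ne (α := ℝ) h (hne x).symm⟩
    rw [this]
    exact isClosed_le continuous_const hF
  exact hclopen.connectedComponent_subset h0 hx

/-- The derivative of `g` at the meeting point multiplies both tangent vectors by the same complex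
number. -/
theorem IsIntersectionAngle.conj {G : Type*} [Group G] {ρ σ : SurfaceRep G}
    (h : (SurfaceRep.conjSetoid G).r ρ σ) {a b : G} {θ : ℝ} (hθ : IsIntersectionAngle ρ a b θ) :
    IsIntersectionAngle σ a b θ := by
  obtain ⟨k, hk⟩ := h
  obtain ⟨g, rfl⟩ := QuotientGroup.mk_surjective k
  obtain ⟨h0, h1, c, c', ⟨hc, m, hm, hcm⟩, ⟨hc', m', hm', hcm'⟩, hcc, v, w, hv, hw, hvw⟩ := hθ
  have htr : ∀ (x : G) (d : ℝ → ℍ) (n : ℝ), (∀ t, ρ.1 x • d t = d (t + n)) →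
      ∀ t, σ.1 x • (g • d t) = g • d (t + n) := by
    intro x d n hd t
    rw [← PSL_mk_smul, hk, mul_smul, mul_smul, inv_smul_smul, hd, PSL_mk_smul]
  refine ⟨h0, h1, fun t => g • c t, fun t => g • c' t,
    ⟨(isometry_smul ℍ g).comp hc, m, hm, htr a c m hcm⟩,
    ⟨(isometry_smul ℍ g).comp hc', m', hm', htr b c' m' hcm'⟩, congrArg (g • ·) hcc, _, _,
    hasDerivAt_SL2_smul g hv, hasDerivAt_SL2_smul g hw, ?_⟩
  rw [hvw, hcc, mul_div_assoc]

theorem IsOrientedAxis.ne_one {G : Type*} [Group G] {ρ : SurfaceRep G} {a : G} {c : ℝ → ℍ}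
    (h : IsOrientedAxis ρ a c) : a ≠ 1 := by
  rintro rfl
  obtain ⟨hc, l, hl, hcl⟩ := h
  have := hcl 0
  rw [map_one, one_smul] at this
  have := hc.injective this
  linarith

theorem continuous_SL2_entry (i j : Fin 2) : Continuous fun A : SL(2, ℝ) => A.1 i j :=
  (continuous_subtype_val (p := fun A : Matrix (Fin 2) (Fin 2) ℝ => A.det = 1)).matrix_elem i j

theorem continuous_SL2_trace : Continuous fun A : SL(2, ℝ) => A.1.trace := by
  simp only [SL2_trace]
  exact (continuous_SL2_entry 0 0).add (continuous_SL2_entry 1 1)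

theorem SL2_trace_neg (A : SL(2, ℝ)) : (-A).1.trace = -A.1.trace := by
  rw [SL2_trace, SL2_trace]
  have h : ∀ i, (-A).1 i i = -A.1 i i := fun i => rfl
  rw [h, h]
  ring

theorem SL2_trace_commutator_conj (g A B : SL(2, ℝ)) :
    ((g * A * g⁻¹) * (g * B * g⁻¹) * (g * A * g⁻¹)⁻¹ * (g * B * g⁻¹)⁻¹).1.trace =
      (A * B * A⁻¹ * B⁻¹).1.trace := by
  have e : (g * A * g⁻¹) * (g * B * g⁻¹) * (g * A * g⁻¹)⁻¹ * (g * B * g⁻¹)⁻¹ =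
      g * (A * B * A⁻¹ * B⁻¹) * g⁻¹ := by group
  rw [e, SL2_trace_conj]

theorem SL2_neg_inv (A : SL(2, ℝ)) : (-A)⁻¹ = -A⁻¹ := by
  rw [inv_eq_iff_mul_eq_one, neg_mul_neg, mul_inv_cancel]

section Lifts

variable {G : Type*} [Group G] (ρ : SurfaceRep G) {a b : G} {A B : SL(2, ℝ)}

/-- The commutator trace `2` is only attained by commuting elements. -/
theorem SurfaceRep.trace_commutator_ne_two (hab : a * b ≠ b * a)
    (hA : QuotientGroup.mk A = ρ.1 a) (hB : QuotientGroup.mk B = ρ.1 b) :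
    2 - (A * B * A⁻¹ * B⁻¹).1.trace ≠ 0 := by
  intro h
  have hne : a * b * a⁻¹ * b⁻¹ ≠ 1 := by
    intro h1
    apply hab
    rwa [mul_inv_eq_one, mul_inv_eq_iff_eq_mul] at h1
  have := ρ.four_lt_trace_sq hne (A := A * B * A⁻¹ * B⁻¹) (by
    rw [map_mul, map_mul, map_mul, map_inv, map_inv, ← hA, ← hB]; rfl)
  rw [← sub_eq_zero.1 h] at this
  norm_num at this

/-- Lifts of commuting elements commute or anticommute. In the second case `B` is conjugate to `-B`
and has trace `0`, so it is not hyperbolic. -/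
theorem SurfaceRep.commute_lifts (hab : a * b = b * a) (hb : b ≠ 1)
    (hA : QuotientGroup.mk A = ρ.1 a) (hB : QuotientGroup.mk B = ρ.1 b) : A * B = B * A := by
  have h : (QuotientGroup.mk (B * A) : PSL(2, ℝ)) = QuotientGroup.mk (A * B) := by
    rw [QuotientGroup.mk_mul, QuotientGroup.mk_mul, hA, hB, ← map_mul, ← map_mul, hab]
  rcases PSL_mk_eq_mk h with h | h
  · exact h
  · have h4 := ρ.four_lt_trace_sq hb hB
    have h5 := SL2_trace_conj A B
    rw [h, show -(B * A) * A⁻¹ = -B by rw [neg_mul, mul_inv_cancel_right], SL2_trace_neg] at h5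
    have : B.1.trace = 0 := by linarith
    rw [this] at h4
    norm_num at h4

theorem crossForm_sq_of_commute (h : A * B = B * A) :
    crossForm A.1 B.1 ^ 2 = axisNormSq A.1 * axisNormSq B.1 := by
  have h1 := crossForm_sq A B
  rw [h, mul_inv_cancel_right, mul_inv_cancel, SL2_trace] at h1
  simp at h1
  linarith

end Lifts

/-! ### The angle for commuting and for crossing pairs -/

/-- On a common axis the sine vanishes, and the sign of `crossForm` tells equal from opposite
directions. -/
theorem isIntersectionAngle_commute {G : Type*} [Group G] (ρ : SurfaceRep G) {a b : G}
    (hab : a * b = b * a) (ha : a ≠ 1) (hb : b ≠ 1) {A B : SL(2, ℝ)}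
    (hA : QuotientGroup.mk A = ρ.1 a) (hB : QuotientGroup.mk B = ρ.1 b) (θ : ℝ) :
    IsIntersectionAngle ρ a b θ ↔
      (crossForm A.1 B.1 < 0 ∧ θ = Real.pi) ∨ (0 < crossForm A.1 B.1 ∧ θ = 0) := by
  have hA4 := ρ.four_lt_trace_sq ha hA
  have hB4 := ρ.four_lt_trace_sq hb hB
  have hc := ρ.commute_lifts hab hb hA hB
  have hpos := mul_pos (axisNormSq_pos hA4) (axisNormSq_pos hB4)
  have hS := Real.sqrt_pos.2 hpos
  have hR : crossSign A.1 B.1 = 0 := by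
    unfold crossSign
    rw [(commute_entries hc).2.2, mul_zero]
  have hK : crossForm A.1 B.1 ^ 2 = √(axisNormSq A.1 * axisNormSq B.1) ^ 2 := by
    rw [crossForm_sq_of_commute hc, Real.sq_sqrt hpos.le]
  rw [isIntersectionAngle_iff ρ hA hB hA4 hB4, hR]
  have hπ := Real.pi_pos
  constructor
  · rintro ⟨h0, h1, z, -, -, hcos, hsin⟩
    rw [mul_zero, mul_eq_zero, or_iff_left hS.ne'] at hsin
    have hθ : θ = 0 ∨ θ = Real.pi := by
      by_contra! hne
      rcases lt_or_ge θ Real.pi with h | h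
      · exact (Real.sin_pos_of_pos_of_lt_pi (lt_of_le_of_ne h0 hne.1.symm) h).ne' hsin
      · have := Real.sin_pos_of_pos_of_lt_pi (x := θ - Real.pi)
          (sub_pos.2 (lt_of_le_of_ne h hne.2.symm)) (by linarith)
        rw [Real.sin_sub_pi, hsin] at this
        simp at this
    rcases hθ with rfl | rfl
    · right
      rw [Real.cos_zero, one_mul] at hcos
      exact ⟨hcos ▸ hS, rfl⟩
    · left
      rw [Real.cos_pi] at hcos
      exact ⟨by linarith, rfl⟩
  · obtain ⟨z, hz⟩ := exists_axisForm_eq_zero hA4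
    have hz' := axisForm_eq_zero_of_commute hA4 hc hz
    rcases sq_eq_sq_iff_eq_or_eq_neg.1 hK with h | h
    · rintro (⟨h1, rfl⟩ | ⟨h1, rfl⟩)
      · linarith
      · exact ⟨le_rfl, by linarith, z, hz, hz', by simp [h], by simp⟩
    · rintro (⟨h1, rfl⟩ | ⟨h1, rfl⟩)
      · exact ⟨hπ.le, by linarith, z, hz, hz', by simp [h], by simp⟩
      · linarith

theorem angleFormula_spec {A B : SL(2, ℝ)} (hA : 4 < A.1.trace ^ 2) (hB : 4 < B.1.trace ^ 2)
    (h : 0 < 2 - (A * B * A⁻¹ * B⁻¹).1.trace) :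
    crossSign A.1 B.1 ≠ 0 ∧ angleCos A.1 B.1 ∈ Set.Ioo (-1) 1 ∧
      angleFormula A.1 B.1 ∈ Set.Ioo 0 (2 * Real.pi) := by
  have hpos := mul_pos (axisNormSq_pos hA) (axisNormSq_pos hB)
  have hS := Real.sqrt_pos.2 hpos
  have hcr := crossForm_sq A B
  have hA' : 0 < A.1.trace ^ 2 := by linarith
  have hB' : 0 < B.1.trace ^ 2 := by linarith
  have hC : angleCos A.1 B.1 ∈ Set.Ioo (-1) 1 := by
    rw [Set.mem_Ioo, ← abs_lt, ← sq_lt_one_iff_abs_lt_one]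
    unfold angleCos
    rw [div_pow, Real.sq_sqrt hpos.le, div_lt_one hpos]
    have : 0 < A.1.trace ^ 2 * B.1.trace ^ 2 * (4 * (2 - (A * B * A⁻¹ * B⁻¹).1.trace)) := by
      positivity
    linarith
  refine ⟨?_, hC, ?_⟩
  · unfold crossSign
    rw [← SL2_trace, ← SL2_trace]
    exact mul_ne_zero (mul_ne_zero (by rintro h; simp [h] at hA') (by rintro h; simp [h] at hB'))
      (exists_axisForm_eq_zero_of_lt h).1
  · have hπ := Real.pi_pos
    have h1 : 0 < Real.arccos (angleCos A.1 B.1) := Real.arccos_pos.2 hC.2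
    have h2 := Real.arccos_le_pi (angleCos A.1 B.1)
    unfold angleFormula
    split_ifs
    · exact ⟨h1, by linarith⟩
    · exact ⟨by linarith, by linarith⟩

theorem exists_cos_sin_eq {x y : ℝ} (h : x ^ 2 + y ^ 2 = 1) :
    ∃ θ : ℝ, 0 ≤ θ ∧ θ < 2 * Real.pi ∧ Real.cos θ = x ∧ Real.sin θ = y := by
  have hx : x ^ 2 ≤ 1 := by nlinarith [sq_nonneg y]
  have hx' := abs_le.1 ((sq_le_one_iff_abs_le_one x).1 hx)
  have hc := Real.cos_arccos hx'.1 hx'.2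
  have hs : Real.sin (Real.arccos x) = |y| := by
    rw [Real.sin_arccos, ← Real.sqrt_sq_eq_abs]
    congr 1
    linarith
  have hπ := Real.pi_pos
  have h0 := Real.arccos_nonneg x
  have h1 := Real.arccos_le_pi x
  rcases le_or_gt 0 y with hy | hy
  · exact ⟨_, h0, by linarith, hc, by rw [hs, abs_of_nonneg hy]⟩
  · refine ⟨2 * Real.pi - Real.arccos x, by linarith, ?_, ?_, ?_⟩
    · have : Real.arccos x ≠ 0 := by
        intro h0
        rw [h0, Real.sin_zero] at hs
        exact (abs_pos.2 hy.ne).ne hs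
      have := lt_of_le_of_ne h0 this.symm
      linarith
    · rw [Real.cos_two_pi_sub, hc]
    · rw [Real.sin_two_pi_sub, hs, abs_of_neg hy, neg_neg]

theorem isIntersectionAngle_of_cross {G : Type*} [Group G] (ρ : SurfaceRep G) {a b : G}
    {A B : SL(2, ℝ)} (hA : QuotientGroup.mk A = ρ.1 a) (hB : QuotientGroup.mk B = ρ.1 b)
    (hA4 : 4 < A.1.trace ^ 2) (hB4 : 4 < B.1.trace ^ 2)
    (h : 0 < 2 - (A * B * A⁻¹ * B⁻¹).1.trace) (θ : ℝ) :
    IsIntersectionAngle ρ a b θ ↔ θ = angleFormula A.1 B.1 := by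
  have hpos := mul_pos (axisNormSq_pos hA4) (axisNormSq_pos hB4)
  have hS := Real.sqrt_pos.2 hpos
  have huniq : ∀ θ, IsIntersectionAngle ρ a b θ → θ = angleFormula A.1 B.1 := by
    intro θ hθ
    obtain ⟨h0, h1, z, -, -, hc, hs⟩ := (isIntersectionAngle_iff ρ hA hB hA4 hB4 θ).1 hθ
    exact eq_angleFormula hA4 hB4 h0 h1 z.im_pos hc hs
  refine ⟨huniq θ, ?_⟩
  rintro rfl
  obtain ⟨-, z, hzA, hzB⟩ := exists_axisForm_eq_zero_of_lt h
  -- Taking moduli in `moebField_mul_conj` yields `cos² + sin² = 1` for the prospective cosine and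
  -- sine.
  have hn : crossForm A.1 B.1 ^ 2 + (2 * z.im * crossSign A.1 B.1) ^ 2 =
      √(axisNormSq A.1 * axisNormSq B.1) ^ 2 := by
    have e := congrArg Complex.normSq (moebField_mul_conj hzA hzB)
    have e1 : ((crossForm A.1 B.1 : ℂ) + 2 * z.im * crossSign A.1 B.1 * Complex.I) =
        ((crossForm A.1 B.1 : ℝ) : ℂ) +
          ((2 * z.im * crossSign A.1 B.1 : ℝ) : ℂ) * Complex.I := by
      push_cast; ring
    rw [e1] at e
    simp only [map_mul, map_pow, Complex.normSq_conj, Complex.normSq_ofReal,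
      Complex.normSq_add_mul_I, normSq_moebField, hzA, hzB] at e
    rw [Real.sq_sqrt hpos.le]
    have eA : A.1.trace ^ 2 * (A.1.trace ^ 2 - 4) = axisNormSq A.1 := by rw [SL2_trace]; rfl
    have eB : B.1.trace ^ 2 * (B.1.trace ^ 2 - 4) = axisNormSq B.1 := by rw [SL2_trace]; rfl
    rw [← eA, ← eB]
    apply mul_left_cancel₀ (pow_ne_zero 4 z.im_pos.ne')
    linear_combination -e
  obtain ⟨θ, h0, h1, hc, hs⟩ := exists_cos_sin_eq
    (x := crossForm A.1 B.1 / √(axisNormSq A.1 * axisNormSq B.1))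
    (y := 2 * z.im * crossSign A.1 B.1 / √(axisNormSq A.1 * axisNormSq B.1)) (by
      rw [div_pow, div_pow, ← add_div, hn, div_self (pow_ne_zero 2 hS.ne')])
  have hθ : IsIntersectionAngle ρ a b θ := by
    rw [isIntersectionAngle_iff ρ hA hB hA4 hB4]
    refine ⟨h0, h1, z, hzA, hzB, ?_, ?_⟩
    · rw [hc, div_mul_cancel₀ _ hS.ne']
    · rw [hs, div_mul_cancel₀ _ hS.ne']
  rw [← huniq θ hθ]
  exact hθ

/-! ### Analyticity, and persistence over Teichmüller space -/

theorem contDiff_entry (n : ℕ) (i : Fin n) (j k : Fin 2) :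
    ContDiff ℝ ⊤ fun e : Fin n → Fin 2 → Fin 2 → ℝ => e i j k :=
  contDiff_apply_apply ℝ ℝ j k |>.comp (contDiff_apply ℝ _ i)

/-- The order `⊤` of smoothness is analyticity; the square root is analytic away from `0`. -/
theorem contDiffAt_angleCos {e : Fin 2 → Fin 2 → Fin 2 → ℝ}
    (he : 0 < axisNormSq (e 0) * axisNormSq (e 1)) :
    ContDiffAt ℝ ⊤ (fun e : Fin 2 → Fin 2 → Fin 2 → ℝ => angleCos (e 0) (e 1)) e := by
  have h : ∀ i j k, ContDiff ℝ ⊤ fun e : Fin 2 → Fin 2 → Fin 2 → ℝ => e i j k := contDiff_entry 2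
  unfold angleCos
  refine ContDiffAt.div ?_ (ContDiffAt.sqrt ?_ he.ne') (Real.sqrt_pos.2 he).ne'
  · unfold crossForm
    fun_prop
  · unfold axisNormSq
    fun_prop

/-- The angle formula is locally one of two real analytic functions. -/
theorem exists_analyticAt_eq_angleFormula (x : Fin 2 → SL(2, ℝ))
    (hA : 4 < (x 0).1.trace ^ 2) (hB : 4 < (x 1).1.trace ^ 2)
    (h : 0 < 2 - (x 0 * x 1 * (x 0)⁻¹ * (x 1)⁻¹).1.trace) :
    ∃ F : (Fin 2 → Fin 2 → Fin 2 → ℝ) → ℝ, AnalyticAt ℝ F (matEntries x) ∧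
      ∀ᶠ y in 𝓝 x, angleFormula (y 0).1 (y 1).1 = F (matEntries y) := by
  obtain ⟨hs, hc, -⟩ := angleFormula_spec hA hB h
  have han : ContDiffAt ℝ ⊤ (fun e : Fin 2 → Fin 2 → Fin 2 → ℝ =>
      Real.arccos (angleCos (e 0) (e 1))) (matEntries x) :=
    ContDiffAt.comp (g := Real.arccos) (matEntries x) (Real.contDiffAt_arccos hc.1.ne' hc.2.ne)
      (contDiffAt_angleCos (e := matEntries x)
        (mul_pos (axisNormSq_pos hA) (axisNormSq_pos hB)))
  have hcont : Continuous fun y : Fin 2 → SL(2, ℝ) => crossSign (y 0).1 (y 1).1 := by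
    have h : ∀ i j k, Continuous fun y : Fin 2 → SL(2, ℝ) => (y i).1 j k :=
      fun i j k => (continuous_SL2_entry j k).comp (continuous_apply i)
    unfold crossSign
    fun_prop
  -- `crossSign` is nonzero, so by continuity the same branch of `angleFormula` applies to all
  -- nearby lifts.
  rcases lt_or_gt_of_ne hs with hs | hs
  · refine ⟨_, (contDiffAt_const (c := 2 * Real.pi)).sub han |>.analyticAt, ?_⟩
    filter_upwards [hcont.continuousAt.eventually_lt_const hs] with y hy
    exact if_neg (not_le.2 hy)
  · refine ⟨_, han.analyticAt, ?_⟩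
    filter_upwards [hcont.continuousAt.eventually_const_lt hs] with y hy
    exact if_pos hy.le

/-- For commuting pairs the square of `crossForm` is a product of positive norms, so its sign cannot
change on a connected component. -/
theorem crossForm_neg_of_mem_Teich {G : Type*} [Group G] {ρ₀ : SurfaceRep G} {a b : G}
    (hab : a * b = b * a) (ha : a ≠ 1) (hb : b ≠ 1) {A₀ B₀ : SL(2, ℝ)}
    (hA₀ : QuotientGroup.mk A₀ = ρ₀.1 a) (hB₀ : QuotientGroup.mk B₀ = ρ₀.1 b)
    (h₀ : crossForm A₀.1 B₀.1 < 0) (ρ : SurfaceRep G) (hρ : repClass ρ ∈ Teich ρ₀)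
    {A B : SL(2, ℝ)} (hA : QuotientGroup.mk A = ρ.1 a) (hB : QuotientGroup.mk B = ρ.1 b) :
    crossForm A.1 B.1 < 0 := by
  obtain ⟨F, hF, hFeq⟩ := exists_continuous_descent (G := G) a b
    (fun p => -(p.1.1.trace * p.2.1.trace * (2 * (p.1 * p.2).1.trace - p.1.1.trace * p.2.1.trace)))
    (by
      have h1 := continuous_SL2_trace.comp (continuous_fst (X := SL(2, ℝ)) (Y := SL(2, ℝ)))
      have h2 := continuous_SL2_trace.comp (continuous_snd (X := SL(2, ℝ)) (Y := SL(2, ℝ)))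
      have h3 := continuous_SL2_trace.comp (continuous_mul (M := SL(2, ℝ)))
      exact ((h1.mul h2).mul ((continuous_const.mul h3).sub (h1.mul h2))).neg)
    (fun A B => by simp only [neg_mul, SL2_trace_neg]; ring)
    (fun A B => by simp only [mul_neg, SL2_trace_neg]; ring)
    (fun g A B => by
      have e : g * A * g⁻¹ * (g * B * g⁻¹) = g * (A * B) * g⁻¹ := by group
      simp only [e, SL2_trace_conj])
  simp only [← crossForm_eq_trace] at hFeq
  have := Teich_pos_of_ne_zero (ρ₀ := ρ₀) hF (fun x => by
    obtain ⟨σ, rfl⟩ := Quotient.exists_rep x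
    obtain ⟨C, hC⟩ := QuotientGroup.mk_surjective (σ.1 a)
    obtain ⟨D, hD⟩ := QuotientGroup.mk_surjective (σ.1 b)
    change F (repClass σ) ≠ 0
    rw [hFeq σ C D hC hD, neg_ne_zero]
    intro h
    have h1 := crossForm_sq_of_commute (σ.commute_lifts hab hb hC hD)
    rw [h] at h1
    have := mul_pos (axisNormSq_pos (σ.four_lt_trace_sq ha hC))
      (axisNormSq_pos (σ.four_lt_trace_sq hb hD))
    simp at h1
    rcases h1 with h1 | h1 <;> rw [h1] at this <;> simp at this)
    (by rw [hFeq ρ₀ A₀ B₀ hA₀ hB₀]; linarith) hρ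
  rw [hFeq ρ A B hA hB] at this
  linarith

/-- A nontrivial commutator is hyperbolic under every representation, so its trace avoids `2` and
stays on one side of it. -/
theorem cross_of_mem_Teich {G : Type*} [Group G] {ρ₀ : SurfaceRep G} {a b : G}
    (hab : a * b ≠ b * a) {A₀ B₀ : SL(2, ℝ)}
    (hA₀ : QuotientGroup.mk A₀ = ρ₀.1 a) (hB₀ : QuotientGroup.mk B₀ = ρ₀.1 b)
    (h₀ : 0 < 2 - (A₀ * B₀ * A₀⁻¹ * B₀⁻¹).1.trace) (ρ : SurfaceRep G) (hρ : repClass ρ ∈ Teich ρ₀)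
    {A B : SL(2, ℝ)} (hA : QuotientGroup.mk A = ρ.1 a) (hB : QuotientGroup.mk B = ρ.1 b) :
    0 < 2 - (A * B * A⁻¹ * B⁻¹).1.trace := by
  obtain ⟨F, hF, hFeq⟩ := exists_continuous_descent (G := G) a b
    (fun p => 2 - (p.1 * p.2 * p.1⁻¹ * p.2⁻¹).1.trace)
    (continuous_const.sub (continuous_SL2_trace.comp
      (((continuous_fst.mul continuous_snd).mul continuous_fst.inv).mul continuous_snd.inv)))
    (fun A B => by simp only [SL2_neg_inv, neg_mul, mul_neg, neg_neg])
    (fun A B => by simp only [SL2_neg_inv, neg_mul, mul_neg, neg_neg])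
    (fun g A B => by simp only [SL2_trace_commutator_conj])
  have := Teich_pos_of_ne_zero (ρ₀ := ρ₀) hF (fun x => by
    obtain ⟨σ, rfl⟩ := Quotient.exists_rep x
    obtain ⟨C, hC⟩ := QuotientGroup.mk_surjective (σ.1 a)
    obtain ⟨D, hD⟩ := QuotientGroup.mk_surjective (σ.1 b)
    change F (repClass σ) ≠ 0
    rw [hFeq σ C D hC hD]
    exact σ.trace_commutator_ne_two hab hC hD)
    (by rw [hFeq ρ₀ A₀ B₀ hA₀ hB₀]; exact h₀) hρ
  rwa [hFeq ρ A B hA hB] at this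

theorem sin_sq_eq {A B : SL(2, ℝ)} (hA : 4 < A.1.trace ^ 2) (hB : 4 < B.1.trace ^ 2) {θ : ℝ}
    (hcos : Real.cos θ * √(axisNormSq A.1 * axisNormSq B.1) = crossForm A.1 B.1) :
    Real.sin θ ^ 2 = 4 * (2 - (A * B * A⁻¹ * B⁻¹).1.trace) /
      ((A.1.trace ^ 2 - 4) * (B.1.trace ^ 2 - 4)) := by
  have hpos := mul_pos (axisNormSq_pos hA) (axisNormSq_pos hB)
  have h := crossForm_sq A B
  have eA : axisNormSq A.1 = A.1.trace ^ 2 * (A.1.trace ^ 2 - 4) := by rw [SL2_trace]; rfl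
  have eB : axisNormSq B.1 = B.1.trace ^ 2 * (B.1.trace ^ 2 - 4) := by rw [SL2_trace]; rfl
  rw [← hcos, mul_pow, Real.sq_sqrt hpos.le, eA, eB] at h
  have h1 : (A.1.trace ^ 2 - 4) * (B.1.trace ^ 2 - 4) ≠ 0 :=
    (mul_pos (sub_pos.2 hA) (sub_pos.2 hB)).ne'
  have h2 : A.1.trace ^ 2 * B.1.trace ^ 2 ≠ 0 := mul_ne_zero (by linarith) (by linarith)
  rw [Real.sin_sq, eq_div_iff h1]
  apply mul_left_cancel₀ h2
  linear_combination h

theorem IsIntersectionAngle.ne_one {G : Type*} [Group G] {ρ₀ : SurfaceRep G} {a b : G} {θ₀ : ℝ}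
    (hmeet : IsIntersectionAngle ρ₀ a b θ₀) : a ≠ 1 ∧ b ≠ 1 := by
  obtain ⟨-, -, c, c', h, h', -⟩ := hmeet
  exact ⟨h.ne_one, h'.ne_one⟩

/-- If the axes of noncommuting elements meet, they cross. -/
theorem cross_of_isIntersectionAngle {G : Type*} [Group G] (ρ : SurfaceRep G) {a b : G}
    (hab : a * b ≠ b * a) (ha : a ≠ 1) (hb : b ≠ 1) {A B : SL(2, ℝ)}
    (hA : QuotientGroup.mk A = ρ.1 a) (hB : QuotientGroup.mk B = ρ.1 b) {θ : ℝ}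
    (h : IsIntersectionAngle ρ a b θ) : 0 < 2 - (A * B * A⁻¹ * B⁻¹).1.trace := by
  have hA4 := ρ.four_lt_trace_sq ha hA
  have hB4 := ρ.four_lt_trace_sq hb hB
  obtain ⟨-, -, z, -, -, hcos, -⟩ := (isIntersectionAngle_iff ρ hA hB hA4 hB4 θ).1 h
  have h1 := sin_sq_eq hA4 hB4 hcos
  have hD := mul_pos (sub_pos.2 hA4) (sub_pos.2 hB4)
  rw [eq_div_iff hD.ne'] at h1
  have h2 : 0 ≤ Real.sin θ ^ 2 * ((A.1.trace ^ 2 - 4) * (B.1.trace ^ 2 - 4)) :=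
    mul_nonneg (sq_nonneg _) hD.le
  exact lt_of_le_of_ne (by linarith) (ρ.trace_commutator_ne_two hab hA hB).symm

/-! ### The main theorem -/

theorem mainTheorem9 {G : Type*} [Group G] (ρ₀ : SurfaceRep G) (a₁ a₂ : G) (θ₀ : ℝ)
    (hmeet : IsIntersectionAngle ρ₀ a₁ a₂ θ₀) (hθ₀ : θ₀ ≠ 0) :
    ∃ θ : Teich ρ₀ → ℝ,
      (∀ x, θ x ∈ Set.Ioo 0 (2 * Real.pi)) ∧
      (∀ (ρ : SurfaceRep G) (hρ : repClass ρ ∈ Teich ρ₀) (φ : ℝ),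
        IsIntersectionAngle ρ a₁ a₂ φ ↔ φ = θ ⟨repClass ρ, hρ⟩) ∧
      IsRealAnalytic θ ∧
      (∀ (ρ : SurfaceRep G) (hρ : repClass ρ ∈ Teich ρ₀) (A₁ A₂ : SL(2, ℝ)),
        QuotientGroup.mk A₁ = ρ.1 a₁ → QuotientGroup.mk A₂ = ρ.1 a₂ →
          4 < A₁.1.trace ^ 2 ∧ 4 < A₂.1.trace ^ 2 ∧
          Real.sin (θ ⟨repClass ρ, hρ⟩) ^ 2 =
            4 * (2 - (A₁ * A₂ * A₁⁻¹ * A₂⁻¹).1.trace) /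
              ((A₁.1.trace ^ 2 - 4) * (A₂.1.trace ^ 2 - 4))) := by
  obtain ⟨ha, hb⟩ := hmeet.ne_one
  obtain ⟨A₀, hA₀⟩ := QuotientGroup.mk_surjective (ρ₀.1 a₁)
  obtain ⟨B₀, hB₀⟩ := QuotientGroup.mk_surjective (ρ₀.1 a₂)
  -- It is enough to find the angle as a function of the lifts.
  suffices H : ∃ Φ : SL(2, ℝ) → SL(2, ℝ) → ℝ,
      (∀ ρ : SurfaceRep G, repClass ρ ∈ Teich ρ₀ → ∀ A B : SL(2, ℝ),
        QuotientGroup.mk A = ρ.1 a₁ → QuotientGroup.mk B = ρ.1 a₂ →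
          Φ A B ∈ Set.Ioo 0 (2 * Real.pi) ∧
          ∀ φ, IsIntersectionAngle ρ a₁ a₂ φ ↔ φ = Φ A B) ∧
      (∀ ρ : SurfaceRep G, repClass ρ ∈ Teich ρ₀ → ∀ x : Fin 2 → SL(2, ℝ),
        QuotientGroup.mk (x 0) = ρ.1 a₁ → QuotientGroup.mk (x 1) = ρ.1 a₂ →
          ∃ F : (Fin 2 → Fin 2 → Fin 2 → ℝ) → ℝ, AnalyticAt ℝ F (matEntries x) ∧
            ∀ᶠ y in 𝓝 x, Φ (y 0) (y 1) = F (matEntries y)) by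
    obtain ⟨Φ, hΦ, han⟩ := H
    have hex : ∀ x : Teich ρ₀, ∃ φ₀ ∈ Set.Ioo 0 (2 * Real.pi), ∀ ρ : SurfaceRep G,
        repClass ρ = x → ∀ φ, IsIntersectionAngle ρ a₁ a₂ φ ↔ φ = φ₀ := by
      rintro ⟨x, hx⟩
      obtain ⟨σ, rfl⟩ := Quotient.exists_rep x
      obtain ⟨A, hA⟩ := QuotientGroup.mk_surjective (σ.1 a₁)
      obtain ⟨B, hB⟩ := QuotientGroup.mk_surjective (σ.1 a₂)
      obtain ⟨h1, h2⟩ := hΦ σ hx A B hA hB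
      refine ⟨Φ A B, h1, fun ρ hρ φ => ?_⟩
      have hr := Quotient.exact hρ
      rw [← h2]
      exact ⟨.conj hr, .conj ((SurfaceRep.conjSetoid G).symm hr)⟩
    choose θ hθ hθ' using hex
    have hval : ∀ (ρ : SurfaceRep G) (hρ : repClass ρ ∈ Teich ρ₀) (A B : SL(2, ℝ)),
        QuotientGroup.mk A = ρ.1 a₁ → QuotientGroup.mk B = ρ.1 a₂ →
          θ ⟨repClass ρ, hρ⟩ = Φ A B := by
      intro ρ hρ A B hA hB
      rw [← (hΦ ρ hρ A B hA hB).2, hθ' ⟨_, hρ⟩ ρ rfl]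
    refine ⟨θ, hθ, fun ρ hρ φ => hθ' ⟨_, hρ⟩ ρ rfl φ, ?_, ?_⟩
    · intro ρ hρ
      obtain ⟨A, hA⟩ := QuotientGroup.mk_surjective (ρ.1 a₁)
      obtain ⟨B, hB⟩ := QuotientGroup.mk_surjective (ρ.1 a₂)
      obtain ⟨F, hF, hFe⟩ := han ρ hρ ![A, B] hA hB
      refine ⟨2, ![a₁, a₂], ![A, B], F, ?_, hF, ?_⟩
      · intro i
        fin_cases i
        · exact hA
        · exact hB
      · filter_upwards [hFe] with y hy σ hσ hlift
        rw [← hy]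
        exact hval σ hσ _ _ (hlift 0) (hlift 1)
    · intro ρ hρ A B hA hB
      have hA4 := ρ.four_lt_trace_sq ha hA
      have hB4 := ρ.four_lt_trace_sq hb hB
      refine ⟨hA4, hB4, ?_⟩
      obtain ⟨-, -, z, -, -, hcos, -⟩ := (isIntersectionAngle_iff ρ hA hB hA4 hB4 _).1
        ((hθ' ⟨_, hρ⟩ ρ rfl _).2 rfl)
      exact sin_sq_eq hA4 hB4 hcos
  -- Commuting elements share their axis, and `θ₀ ≠ 0` leaves only opposite directions.
  by_cases hab : a₁ * a₂ = a₂ * a₁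
  · have h₀ : crossForm A₀.1 B₀.1 < 0 := by
      rcases (isIntersectionAngle_commute ρ₀ hab ha hb hA₀ hB₀ θ₀).1 hmeet with h | h
      · exact h.1
      · exact absurd h.2 hθ₀
    have hπ := Real.pi_pos
    refine ⟨fun _ _ => Real.pi, fun ρ hρ A B hA hB => ⟨⟨hπ, by linarith⟩, fun φ => ?_⟩,
      fun ρ hρ x _ _ => ⟨fun _ => Real.pi, analyticAt_const, .of_forall fun _ => rfl⟩⟩
    have hneg := crossForm_neg_of_mem_Teich hab ha hb hA₀ hB₀ h₀ ρ hρ hA hB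
    rw [isIntersectionAngle_commute ρ hab ha hb hA hB]
    simp [hneg, not_lt.2 hneg.le]
  · have h₀ := cross_of_isIntersectionAngle ρ₀ hab ha hb hA₀ hB₀ hmeet
    refine ⟨fun A B => angleFormula A.1 B.1, fun ρ hρ A B hA hB => ?_, fun ρ hρ x hA hB => ?_⟩
    · have h := cross_of_mem_Teich hab hA₀ hB₀ h₀ ρ hρ hA hB
      have hA4 := ρ.four_lt_trace_sq ha hA
      have hB4 := ρ.four_lt_trace_sq hb hB
      exact ⟨(angleFormula_spec hA4 hB4 h).2.2,
        isIntersectionAngle_of_cross ρ hA hB hA4 hB4 h⟩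
    · exact exists_analyticAt_eq_angleFormula x (ρ.four_lt_trace_sq ha hA)
        (ρ.four_lt_trace_sq hb hB) (cross_of_mem_Teich hab hA₀ hB₀ h₀ ρ hρ hA hB)
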